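/- \textbf{Reciprocity for Bernoulli polynomials.} Let $r\ge 0$, let $\nu=(\nu_0,\dots,\nu_r)$ be a vector of pairwise distinct and pairwise coprime positive integers, and let $q=(q_0,\dots,q_r)$ be a vector of positive integers. Let $b_q(x)=B_q(\{x\})$ be the $q$-th periodic Bernoulli function, where $B_q(x)$ is the $q$-th Bernoulli polynomial and $\{x\}$ the fractional part of $x$, and let $B_q=B_q(0)$ be the Bernoulli numbers. For functions $f_0,\dots,f_r:\mathbb R\to\mathbb C$ that are $1$-periodic and have one-sided limits, put $$S_{\mathbf f}(\nu\,|\,\nu_k)=\sum_{i=1}^{\nu_k-1}\prod_{j\ne k}f_j\!\left(\frac{i\nu_j}{\nu_k}\right),\qquad \Delta f_k=f_k(1^-)-f_k(0^+),\qquad R_{\mathbf f}(\nu)=\sum_{k=0}^r S_{\mathbf f}(\nu\,|\,\nu_k)\,\Delta f_k ,$$ and write $R_{b_q}(\nu)$ for $R_{\mathbf f}(\nu)$ with $f_j=b_{q_j}$. Let $\nu^\perp_{\mathbb Z}=\{n\in\mathbb Z^{r+1}:\sum_j\nu_jn_j=0\}$ and $$\zeta_{k,\nu,q}=\sum_{n\in\nu^\perp_{\mathbb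 Z}}\ \prod_{j\neq k}\frac1{n_j^{q_j}},$$ where $1/0^{m}$ is read as $0$ for $m\ge1$. If this series does not converge absolutely, $\zeta_{k,\nu,q}$ denotes its principal value, that is, the limit as $N\to\infty$ of its partial sums over all $n\in\nu^\perp_{\mathbb Z}$ with $|n_j|\le N$ for all $j=0,\dots,r$ (including $j=k$). Finally, let $1_q=\#\{j:q_j=1\}$, $|q|=q_0+\dots+q_r$ and $$I_{\bar q}=\frac{(-1)^r}{(2\pi i)^{|q|-1}}\prod_{q_j>1}q_j!\,.$$ Then for each $k$ with $q_k=1$ the value $\zeta_{k,\nu,q}$ exists (the above partial sums converge to it), and $$R_{b_q}(\nu)=I_{\bar q}\sum_{k:\,q_k=1}\nu_k\,\zeta_{k,\nu,q}-\frac{1-(-1)^{1_q}}{2^{1_q}}\prod_{q_j\ne1}B_{q_j}.$$ -/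

import Mathlib

open Filter Topology

namespace DedekindReciprocity

noncomputable section

/-- The periodic Bernoulli function `b_q(x) = B_q({x})`. -/
def periodicBernoulli (q : ℕ) (x : ℝ) : ℂ :=
  (bernoulliFun q (Int.fract x) : ℂ)

/-- The jump `Δf = f(1⁻) - f(0⁺)` of a `1`-periodic function. -/
def jump (f : ℝ → ℂ) : ℂ :=
  Function.leftLim f 1 - Function.rightLim f 0

/-- The generalized Dedekind sum
`S_f(ν | ν_k) = ∑_{i=1}^{ν_k - 1} ∏_{j ≠ k} f_j (i ν_j / ν_k)`. -/
def dedekindSum {r : ℕ} (f : Fin (r + 1) → ℝ → ℂ) (ν : Fin (r + 1) → ℕ) (k : Fin (r + 1)) : ℂ :=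
  ∑ i ∈ Finset.Ico 1 (ν k), ∏ j ∈ Finset.univ.erase k, f j ((i : ℝ) * (ν j : ℝ) / (ν k : ℝ))

/-- The reciprocity `R_f(ν) = ∑_k S_f(ν | ν_k) Δf_k`. -/
def reciprocity {r : ℕ} (f : Fin (r + 1) → ℝ → ℂ) (ν : Fin (r + 1) → ℕ) : ℂ :=
  ∑ k, dedekindSum f ν k * jump (f k)

/-- The lattice of integer vectors orthogonal to `ν`. -/
def orthogonalLattice {r : ℕ} (ν : Fin (r + 1) → ℕ) : Set (Fin (r + 1) → ℤ) :=
  {n | ∑ j, (ν j : ℤ) * n j = 0}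

/-- The vector `q_k`, i.e. `q` with its `k`-th entry replaced by `0`. -/
def dropExponent {r : ℕ} (q : Fin (r + 1) → ℕ) (k : Fin (r + 1)) : Fin (r + 1) → ℕ :=
  Function.update q k 0

/-- The term `1 / n^q = ∏_j n_j^{-q_j}`, with `0^0 = 1` and `0^{-q_j} = 0` for `q_j ≥ 1`. -/
def invPow {r : ℕ} (q : Fin (r + 1) → ℕ) (n : Fin (r + 1) → ℤ) : ℂ :=
  ∏ j, ((n j : ℂ) ^ q j)⁻¹

/-- The symmetric partial sum of `∑ 1 / n^{q_k}` over the orthogonal lattice: the (finite) sum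
over its points `n` with `|n_j| ≤ N` for all `j`. -/
def zetaPartial {r : ℕ} (ν q : Fin (r + 1) → ℕ) (k : Fin (r + 1)) (N : ℕ) : ℂ :=
  ∑ n ∈ (Fintype.piFinset fun _ : Fin (r + 1) => Finset.Icc (-(N : ℤ)) (N : ℤ)) with
    ∑ j, (ν j : ℤ) * n j = 0, invPow (dropExponent q k) n

open Classical in
/-- The multiple zeta value `ζ_{k,ν,q} = ∑_{n ∈ ν^⊥} 1 / n^{q_k}`: the sum of the series if it
converges absolutely, and otherwise its principal value, the limit of the symmetric partial sums. -/
def latticeZeta {r : ℕ} (ν q : Fin (r + 1) → ℕ) (k : Fin (r + 1)) : ℂ :=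
  if Summable (fun n : orthogonalLattice ν => invPow (dropExponent q k) n) then
    ∑' n : orthogonalLattice ν, invPow (dropExponent q k) n
  else limUnder atTop (zetaPartial ν q k)

/-- The number of indices `j` with `q_j = 1`. -/
def onesCount {r : ℕ} (q : Fin (r + 1) → ℕ) : ℕ :=
  (Finset.univ.filter fun j => q j = 1).card

/-- The constant `(-1)^r / (2πi)^{|q| - 1} ∏_{q_j > 1} q_j!`. -/
def reciprocityConst {r : ℕ} (q : Fin (r + 1) → ℕ) : ℂ :=
  (-1) ^ r / (2 * (Real.pi : ℂ) * Complex.I) ^ ((∑ j, q j) - 1) *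
    ∏ j with 1 < q j, ((q j).factorial : ℂ)

end

end DedekindReciprocity

namespace DedekindReciprocity

open MeasureTheory Set

noncomputable section

/-! Fix `k` with `q k = 1`. Truncating the lattice sum to the box `|n_j| ≤ N` and detecting `∑ ν_j
n_j = 0` by orthogonality turns the constant times the partial zeta sum into `∫_0^1 D_N(ν_k x)
∏_{j≠k} b_{q_j,N}(ν_j x) dx`. Here `D_N` is the Dirichlet kernel (the factor with exponent 0) and
`b_{q,N}` is a Fourier partial sum of the periodic Bernoulli function
(`zetaPartial_mul_reciprocityConst`). The kernel puts mass `1/ν_k` near each point `i/ν_k`.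

For `i ≠ 0`, coprimality keeps every `ν_j i/ν_k` away from the integers. The other factors are then
uniformly Lipschitz near the point and converge there, which yields the Dedekind sum divided by
`ν_k` (`tendsto_integral_dirichlet_mul_of_near_const`).

At the origin the factors with `q_j = 1` jump at the same scale `1/N` as the kernel (Gibbs
phenomenon): `b_{1,N}(x) = -Si((2N+1)x) + O(|x|)`, where `Si` is `sineInt`. Rescaling leaves `∏
B_{q_j}` over `q_j ≠ 1`, times `T_k = ∫ sinc(πν_k t) ∏ (-Si(ν_j t)) dt` over the remaining `j` with
`q_j = 1` (`tendsto_integral_dirichlet_mul_of_near_scaled`). This integral is only conditionally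
convergent.

No single `T_k` is computed. By the product rule `∑ ν_k T_k` is minus the total variation between
the ends of `∏ (-Si(ν_j t))`, and `Si(±∞) = ±1/2` gives the explicit Bernoulli correction
(`tendsto_sum_integral_sincPi_mul_prod`). Since `b_q` jumps at integers only for `q = 1`, summing
over these `k` gives the reciprocity. -/

/-- The odd integer `2N + 1`, as a real number. -/
def oddFreq (N : ℕ) : ℝ := 2 * N + 1

theorem oddFreq_pos (N : ℕ) : 0 < oddFreq N := by unfold oddFreq; positivity

theorem tendsto_oddFreq : Tendsto oddFreq atTop atTop :=
  tendsto_atTop_add_const_right _ _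
    (tendsto_natCast_atTop_atTop.const_mul_atTop (by norm_num : (0 : ℝ) < 2))

/-! ### Oscillatory integrals -/

/-- The **Riemann-Lebesgue lemma** for `sin`. -/
theorem tendsto_integral_sin_mul (f : ℝ → ℂ) (hf : Integrable f) :
    Tendsto (fun w : ℝ => ∫ x, (Real.sin (w * x) : ℂ) * f x) atTop (𝓝 0) := by
  have h := Real.tendsto_integral_exp_smul_cocompact f
  have hg (w : ℝ) : Integrable fun v => Real.fourierChar (-(v * w)) • f v := by
    simpa [mul_comm] using (Real.fourierIntegral_convergent_iff (μ := volume) (f := f) w).2 hf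
  have hpi : (0 : ℝ) < (2 * Real.pi)⁻¹ := by positivity
  have h1 : Tendsto (fun w : ℝ => (2 * Real.pi)⁻¹ * w) atTop (cocompact ℝ) :=
    (tendsto_id.const_mul_atTop hpi).mono_right atTop_le_cocompact
  have h2 : Tendsto (fun w : ℝ => -((2 * Real.pi)⁻¹ * w)) atTop (cocompact ℝ) :=
    (tendsto_neg_atTop_atBot.comp (tendsto_id.const_mul_atTop hpi)).mono_right
      atBot_le_cocompact
  have h3 := ((h.comp h2).sub (h.comp h1)).const_mul (1 / (2 * Complex.I))
  simp only [sub_zero, mul_zero] at h3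
  refine h3.congr fun w => ?_
  simp only [Function.comp_apply]
  rw [← integral_sub, ← integral_const_mul]
  · congr 1
    ext x
    rw [Circle.smul_def, Circle.smul_def, Real.fourierChar_apply, Real.fourierChar_apply]
    simp only [smul_eq_mul]
    rw [Complex.ofReal_sin, Complex.sin]
    have e1 : ((2 * Real.pi * -(x * -((2 * Real.pi)⁻¹ * w)) : ℝ) : ℂ) * Complex.I
        = ((w * x : ℝ) : ℂ) * Complex.I := by
      congr 2; field_simp
    have e2 : ((2 * Real.pi * -(x * ((2 * Real.pi)⁻¹ * w)) : ℝ) : ℂ) * Complex.I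
        = -((w * x : ℝ) : ℂ) * Complex.I := by
      rw [← Complex.ofReal_neg]; congr 2; field_simp
    rw [e1, e2]
    field_simp
    linear_combination (f x * (Complex.exp (Complex.I * ↑(w * x)) -
      Complex.exp (-(Complex.I * ↑(w * x))))) * Complex.I_sq
  all_goals exact hg _

/-- A uniform Riemann-Lebesgue lemma for bounded, pointwise convergent sequences. -/
theorem tendsto_intervalIntegral_sin_mul {a b c C : ℝ} (hc : 0 < c) (hab : a ≤ b)
    {A : ℕ → ℝ → ℂ} (meas : ∀ N, Measurable (A N))
    (bdd : ∀ N, ∀ x ∈ Ioc a b, ‖A N x‖ ≤ C)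
    (conv : ∀ x ∈ Ioc a b, ∃ l, Tendsto (fun N => A N x) atTop (𝓝 l)) :
    Tendsto (fun N => ∫ x in a..b, (Real.sin (oddFreq N * Real.pi * (c * x)) : ℂ) * A N x)
      atTop (𝓝 0) := by
  -- Write `A N = L + (A N - L)`: Riemann-Lebesgue handles the fixed limit `L`, and dominated
  -- convergence with bound `2C` handles the difference, whatever the oscillating factor does.
  choose! L hL using conv
  set μ := volume.restrict (Ioc a b) with hμ
  have hmem : ∀ᵐ x ∂μ, x ∈ Ioc a b := ae_restrict_mem measurableSet_Ioc
  have hLmeas : AEStronglyMeasurable L μ :=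
    aestronglyMeasurable_of_tendsto_ae atTop (fun N => (meas N).aestronglyMeasurable)
      (hmem.mono fun x hx => hL x hx)
  have hLbdd : ∀ x ∈ Ioc a b, ‖L x‖ ≤ C := fun x hx =>
    le_of_tendsto (hL x hx).norm (Eventually.of_forall fun N => bdd N x hx)
  have hLint : Integrable L μ :=
    Integrable.of_bound hLmeas C (hmem.mono fun x hx => hLbdd x hx)
  have hfreq : Tendsto (fun N => oddFreq N * Real.pi * c) atTop atTop :=
    (tendsto_oddFreq.atTop_mul_const Real.pi_pos).atTop_mul_const hc
  have h1 : Tendsto (fun N => ∫ x, (Real.sin (oddFreq N * Real.pi * (c * x)) : ℂ) * L x ∂μ)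
      atTop (𝓝 0) := by
    have := (tendsto_integral_sin_mul ((Ioc a b).indicator L)
      ((integrable_indicator_iff measurableSet_Ioc).2 hLint)).comp hfreq
    refine this.congr fun N => ?_
    simp only [Function.comp_apply]
    rw [hμ, ← integral_indicator measurableSet_Ioc]
    congr 1
    ext x
    by_cases hx : x ∈ Ioc a b <;> simp [hx, mul_assoc]
  have hsin : ∀ N (x : ℝ), ‖(Real.sin (oddFreq N * Real.pi * (c * x)) : ℂ)‖ ≤ 1 := fun N x => by
    rw [Complex.norm_real]; exact Real.abs_sin_le_one _
  have hsinm : ∀ N, Measurable fun x : ℝ => (Real.sin (oddFreq N * Real.pi * (c * x)) : ℂ) :=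
    fun N => (by fun_prop : Continuous _).measurable
  have h2 : Tendsto (fun N => ∫ x, (Real.sin (oddFreq N * Real.pi * (c * x)) : ℂ) *
      (A N x - L x) ∂μ) atTop (𝓝 (∫ x, 0 ∂μ)) := by
    refine tendsto_integral_of_dominated_convergence (fun _ => C + C) (fun N => ?_)
      (integrable_const _) (fun N => ?_) ?_
    · exact (hsinm N).aestronglyMeasurable.mul ((meas N).aestronglyMeasurable.sub hLmeas)
    · filter_upwards [hmem] with x hx
      rw [norm_mul]
      calc _ ≤ 1 * (C + C) := mul_le_mul (hsin N x)
            ((norm_sub_le _ _).trans (add_le_add (bdd N x hx) (hLbdd x hx)))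
            (norm_nonneg _) zero_le_one
        _ = _ := one_mul _
    · filter_upwards [hmem] with x hx
      have h0 : Tendsto (fun N => ‖A N x - L x‖) atTop (𝓝 0) := by
        simpa using ((hL x hx).sub_const (L x)).norm
      refine squeeze_zero_norm (fun N => ?_) h0
      rw [norm_mul]
      exact mul_le_of_le_one_left (norm_nonneg _) (hsin N x)
  rw [integral_zero] at h2
  have h3 := h1.add h2
  rw [add_zero] at h3
  refine h3.congr fun N => ?_
  rw [intervalIntegral.integral_of_le hab, ← integral_add]
  · congr 1; ext x; ring
  · refine hLint.bdd_mul (c := 1) (hsinm N).aestronglyMeasurable (.of_forall (hsin N))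
  · refine Integrable.bdd_mul (c := 1) ?_ (hsinm N).aestronglyMeasurable (.of_forall (hsin N))
    refine Integrable.sub ?_ hLint
    exact Integrable.of_bound (meas N).aestronglyMeasurable C (hmem.mono fun x hx => bdd N x hx)

/-! ### The sine integral -/

/-- The function `sin (πu) / (πu)` with complex values. -/
def sincPi (u : ℝ) : ℂ := (Real.sinc (Real.pi * u) : ℂ)

theorem continuous_sincPi : Continuous sincPi :=
  Complex.continuous_ofReal.comp (Real.continuous_sinc.comp (continuous_const.mul continuous_id))

theorem sincPi_neg (u : ℝ) : sincPi (-u) = sincPi u := by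
  simp [sincPi, Real.sinc_neg]

theorem norm_sincPi_le {u : ℝ} (hu : 0 < u) : ‖sincPi u‖ ≤ 1 / u := by
  have hne : Real.pi * u ≠ 0 := by positivity
  rw [sincPi, Complex.norm_real, Real.sinc_of_ne_zero hne, Real.norm_eq_abs, abs_div]
  have h1 := Real.abs_sin_le_one (Real.pi * u)
  rw [abs_of_pos (a := Real.pi * u) (by positivity)]
  rw [div_le_div_iff₀ (by positivity) hu]
  have : (1 : ℝ) ≤ Real.pi := by linarith [Real.pi_gt_three]
  nlinarith

/-- The sine integral `∫_0^u sin (πt) / (πt) dt`. -/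
def sineInt (u : ℝ) : ℂ := ∫ t in (0 : ℝ)..u, sincPi t

theorem hasDerivAt_sineInt (u : ℝ) : HasDerivAt sineInt (sincPi u) u :=
  intervalIntegral.integral_hasDerivAt_right (continuous_sincPi.intervalIntegrable _ _)
    (continuous_sincPi.stronglyMeasurableAtFilter _ _) continuous_sincPi.continuousAt

theorem continuous_sineInt : Continuous sineInt :=
  continuous_iff_continuousAt.2 fun u => (hasDerivAt_sineInt u).continuousAt

theorem sineInt_neg (u : ℝ) : sineInt (-u) = -sineInt u := by
  have h := intervalIntegral.integral_comp_neg (a := 0) (b := u) sincPi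
  simp only [sincPi_neg, neg_zero] at h
  rw [sineInt, sineInt, h, intervalIntegral.integral_symm]

/-- Integration by parts: `∫_0^A sin (πcu) / (πcu) P(u) du` converges as `A → ∞`, for bounded
`P` with `P' = O(1/u)`. -/
theorem exists_tendsto_integral_sincPi_mul {c C C' : ℝ} (hc : 0 < c) {P P' : ℝ → ℂ}
    (hP : ∀ u, HasDerivAt P (P' u) u) (hP' : Continuous P')
    (bdd : ∀ u, 0 < u → ‖P u‖ ≤ C) (bdd' : ∀ u, 0 < u → ‖P' u‖ ≤ C' / u) :
    ∃ l, Tendsto (fun A : ℝ => ∫ u in (0 : ℝ)..A, sincPi (c * u) * P u) atTop (𝓝 l) := by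
  have hPc : Continuous P := continuous_iff_continuousAt.2 fun u => (hP u).continuousAt
  have hcont : Continuous fun u => sincPi (c * u) * P u :=
    (continuous_sincPi.comp (continuous_const.mul continuous_id)).mul hPc
  have hC : 0 ≤ C := (norm_nonneg _).trans (bdd 1 one_pos)
  have hC' : 0 ≤ C' := by simpa using (norm_nonneg _).trans (bdd' 1 one_pos)
  -- `v` is an antiderivative of `sin(πcu)/(πc)` and `w = P/u`, so `v w → 0` and `v w'` is `O(u⁻²)`.
  -- The parts formula is applied on `[1, A]` only, away from the pole of `1/u`.
  set v : ℝ → ℂ := fun u => ((-(Real.cos (Real.pi * c * u) / (Real.pi * c) ^ 2) : ℝ) : ℂ) with hv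
  set w : ℝ → ℂ := fun u => ((u⁻¹ : ℝ) : ℂ) * P u with hw
  set w' : ℝ → ℂ := fun u => ((-(u ^ 2)⁻¹ : ℝ) : ℂ) * P u + ((u⁻¹ : ℝ) : ℂ) * P' u with hw'
  have hpc : 0 < Real.pi * c := by positivity
  have dv : ∀ u, HasDerivAt v ((Real.sin (Real.pi * c * u) / (Real.pi * c) : ℝ) : ℂ) u := by
    intro u
    have h : HasDerivAt (fun u : ℝ => -(Real.cos (Real.pi * c * u) / (Real.pi * c) ^ 2))
        (Real.sin (Real.pi * c * u) / (Real.pi * c)) u := by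
      have h1 : HasDerivAt (fun u : ℝ => Real.pi * c * u) (Real.pi * c) u := by
        simpa using (hasDerivAt_id u).const_mul (Real.pi * c)
      convert! (h1.cos.div_const ((Real.pi * c) ^ 2)).neg using 1
      field_simp
    exact h.ofReal_comp
  have dw : ∀ u, u ≠ 0 → HasDerivAt w (w' u) u := fun u hu =>
    (hasDerivAt_inv hu).ofReal_comp.mul (hP u)
  have hvn : ∀ u, ‖v u‖ ≤ 1 / (Real.pi * c) ^ 2 := by
    intro u
    rw [hv, Complex.norm_real, norm_neg, norm_div, Real.norm_eq_abs, Real.norm_eq_abs,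
      abs_of_pos (a := (Real.pi * c) ^ 2) (by positivity)]
    gcongr
    exact Real.abs_cos_le_one _
  have hwn : ∀ u, 0 < u → ‖w u‖ ≤ C * u⁻¹ := by
    intro u hu
    rw [hw, norm_mul, Complex.norm_real, Real.norm_eq_abs, abs_of_pos (inv_pos.2 hu), mul_comm]
    gcongr
    exact bdd u hu
  have hwn' : ∀ u, 0 < u → ‖w' u‖ ≤ (C + C') * (u ^ 2)⁻¹ := by
    intro u hu
    rw [hw', add_mul]
    refine (norm_add_le _ _).trans (add_le_add ?_ ?_)
    · rw [norm_mul, Complex.norm_real, norm_neg, Real.norm_eq_abs, abs_of_pos (by positivity),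
        mul_comm]
      gcongr
      exact bdd u hu
    · rw [norm_mul, Complex.norm_real, Real.norm_eq_abs, abs_of_pos (by positivity)]
      calc _ ≤ u⁻¹ * (C' / u) := by gcongr; exact bdd' u hu
        _ = _ := by field_simp
  have hvc : Continuous v := continuous_iff_continuousAt.2 fun u => (dv u).continuousAt
  have hw'c : ContinuousOn w' (Ici 1) := by
    have hne : ∀ u ∈ Ici (1 : ℝ), u ≠ 0 := fun u hu => (lt_of_lt_of_le one_pos hu).ne'
    have h1 : ContinuousOn (fun u : ℝ => u⁻¹) (Ici 1) := continuousOn_inv₀.mono hne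
    have h2 : ContinuousOn (fun u : ℝ => -(u ^ 2)⁻¹) (Ici 1) :=
      ((continuous_pow 2).continuousOn.inv₀ fun u hu => pow_ne_zero 2 (hne u hu)).neg
    exact ((Complex.continuous_ofReal.comp_continuousOn h2).mul hPc.continuousOn).add
      ((Complex.continuous_ofReal.comp_continuousOn h1).mul hP'.continuousOn)
  have hint : IntegrableOn (fun u => v u * w' u) (Ioi 1) := by
    have hdom : IntegrableOn (fun u : ℝ => 1 / (Real.pi * c) ^ 2 * ((C + C') * u ^ (-2 : ℝ)))
        (Ioi 1) :=
      ((integrableOn_Ioi_rpow_of_lt (by norm_num) one_pos).const_mul _).const_mul _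
    refine Integrable.mono' hdom ?_ ?_
    · exact ((hvc.continuousOn.mul hw'c).mono Ioi_subset_Ici_self).aestronglyMeasurable
        measurableSet_Ioi
    · filter_upwards [ae_restrict_mem measurableSet_Ioi] with u hu
      have hu0 : (0 : ℝ) < u := lt_trans one_pos hu
      rw [norm_mul, Real.rpow_neg hu0.le, Real.rpow_two]
      exact mul_le_mul (hvn u) (hwn' u hu0) (norm_nonneg _) (by positivity)
  have hlim := intervalIntegral_tendsto_integral_Ioi 1 hint tendsto_id
  have hbd : Tendsto (fun A => v A * w A) atTop (𝓝 0) := by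
    have h0 : Tendsto (fun u : ℝ => 1 / (Real.pi * c) ^ 2 * (C * u⁻¹)) atTop (𝓝 0) := by
      have := (tendsto_inv_atTop_zero (𝕜 := ℝ).const_mul C).const_mul (1 / (Real.pi * c) ^ 2)
      rwa [mul_zero, mul_zero] at this
    refine squeeze_zero_norm' ?_ h0
    filter_upwards [eventually_gt_atTop 0] with u hu
    rw [norm_mul]
    exact mul_le_mul (hvn u) (hwn u hu) (norm_nonneg _) (by positivity)
  refine ⟨(∫ u in (0 : ℝ)..1, sincPi (c * u) * P u) +
    (0 - v 1 * w 1 - ∫ u in Ioi 1, v u * w' u), ?_⟩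
  refine (tendsto_const_nhds.add ((hbd.sub_const _).sub hlim)).congr' ?_
  filter_upwards [eventually_ge_atTop 1] with A hA
  rw [← intervalIntegral.integral_add_adjacent_intervals (hcont.intervalIntegrable 0 1)
    (hcont.intervalIntegrable 1 A)]
  congr 1
  have hsub : uIcc 1 A ⊆ Ici 1 := by rw [uIcc_of_le hA]; exact Icc_subset_Ici_self
  have key := intervalIntegral.integral_mul_deriv_eq_deriv_mul (a := 1) (b := A)
    (u := v) (v := w) (u' := fun u => ((Real.sin (Real.pi * c * u) / (Real.pi * c) : ℝ) : ℂ))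
    (v' := w') (fun u _ => dv u) (fun u hu => dw u (lt_of_lt_of_le one_pos (hsub hu)).ne')
    (Continuous.intervalIntegrable (by fun_prop) _ _)
    ((hw'c.mono hsub).intervalIntegrable)
  simp only [id]
  rw [key]
  rw [sub_sub_cancel]
  refine intervalIntegral.integral_congr fun u hu => ?_
  have hu0 : (0 : ℝ) < u := lt_of_lt_of_le one_pos (hsub hu)
  simp only [hw, sincPi]
  rw [Real.sinc_of_ne_zero (by positivity), ← mul_assoc, ← Complex.ofReal_mul]
  congr 2
  rw [← mul_assoc]
  field_simp

/-! ### Partial Fourier sums -/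

/-- The character `e(nx) = exp (2πinx)`. -/
def expZ (n : ℤ) (x : ℝ) : ℂ := Complex.exp (2 * Real.pi * Complex.I * n * x)

theorem continuous_expZ (n : ℤ) : Continuous (expZ n) := by unfold expZ; fun_prop

theorem norm_expZ (n : ℤ) (x : ℝ) : ‖expZ n x‖ = 1 := by
  have : expZ n x = Complex.exp ((2 * Real.pi * n * x : ℝ) * Complex.I) := by
    unfold expZ; congr 1; push_cast; ring
  rw [this, Complex.norm_exp_ofReal_mul_I]

theorem expZ_add_intCast (n m : ℤ) (x : ℝ) : expZ n (x + m) = expZ n x := by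
  unfold expZ
  rw [← Complex.exp_periodic.int_mul (n * m) (2 * Real.pi * Complex.I * n * x)]
  congr 1; push_cast; ring

theorem hasDerivAt_expZ (n : ℤ) (x : ℝ) :
    HasDerivAt (expZ n) (2 * Real.pi * Complex.I * n * expZ n x) x := by
  have h := ((Complex.ofRealCLM.hasDerivAt (x := x)).const_mul
    (2 * Real.pi * Complex.I * n : ℂ)).cexp
  simp only [Complex.ofRealCLM_apply, Complex.ofReal_one, mul_one] at h
  rw [mul_comm (_ * _ * _ * _ : ℂ)]
  exact h

/-- The partial sum `∑_{|n| ≤ N} e(nx) / n^q`; for `q = 0` this is the Dirichlet kernel. -/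
def powSum (q N : ℕ) (x : ℝ) : ℂ :=
  ∑ n ∈ Finset.Icc (-(N : ℤ)) N, ((n : ℂ) ^ q)⁻¹ * expZ n x

theorem continuous_powSum (q N : ℕ) : Continuous (powSum q N) := by
  unfold powSum
  exact continuous_finsetSum _ fun n _ => continuous_const.mul (continuous_expZ n)

theorem powSum_add_intCast (q N : ℕ) (x : ℝ) (m : ℤ) : powSum q N (x + m) = powSum q N x := by
  simp [powSum, expZ_add_intCast]

theorem powSum_neg (q N : ℕ) (x : ℝ) : powSum q N (-x) = (-1) ^ q * powSum q N x := by
  unfold powSum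
  rw [Finset.mul_sum]
  refine Finset.sum_nbij' (fun n => -n) (fun n => -n) ?_ ?_ ?_ ?_ ?_
  · intro n; simp only [Finset.mem_Icc]; omega
  · intro n; simp only [Finset.mem_Icc]; omega
  · simp
  · simp
  · intro n _
    have h1 : expZ (-n) x = expZ n (-x) := by
      unfold expZ; congr 1; push_cast; ring
    rw [h1, ← mul_assoc]
    congr 1
    rw [Int.cast_neg, ← inv_pow, ← inv_pow, ← mul_pow, inv_neg]
    simp

/-- Differentiation cancels one power of `n`. The term `n = 0` is absent from the exponent `q + 1`,
but for `q = 0` it contributes `1` to the Dirichlet kernel, hence the correction. -/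
theorem hasDerivAt_powSum_succ (q N : ℕ) (x : ℝ) :
    HasDerivAt (powSum (q + 1) N)
      (2 * Real.pi * Complex.I * (powSum q N x - if q = 0 then 1 else 0)) x := by
  have h : HasDerivAt (powSum (q + 1) N) (∑ n ∈ Finset.Icc (-(N : ℤ)) N,
      ((n : ℂ) ^ (q + 1))⁻¹ * (2 * Real.pi * Complex.I * n * expZ n x)) x := by
    unfold powSum
    exact HasDerivAt.fun_sum fun n _ => (hasDerivAt_expZ n x).const_mul _
  convert! h using 1
  have h0 : (if q = 0 then (1 : ℂ) else 0) =
      ∑ n ∈ Finset.Icc (-(N : ℤ)) N, if n = 0 then (if q = 0 then (1 : ℂ) else 0) else 0 := by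
    rw [Finset.sum_ite_eq' _ (0 : ℤ), if_pos (Finset.mem_Icc.2 ⟨by omega, by omega⟩)]
  rw [h0, powSum, ← Finset.sum_sub_distrib, Finset.mul_sum]
  refine Finset.sum_congr rfl fun n _ => ?_
  by_cases hn : n = 0
  · subst hn
    by_cases hq : q = 0 <;> simp [hq, expZ]
  · have : (n : ℂ) ≠ 0 := by exact_mod_cast hn
    simp only [hn, if_false]
    field_simp
    ring

/-- Raising `N` adds `2 cos(2π(N+1)x)`, and multiplying by `sin(πx)` makes the sum telescope. The
product form remains valid at integers. -/
theorem powSum_zero_mul_sin (N : ℕ) (x : ℝ) :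
    powSum 0 N x * (Real.sin (Real.pi * x) : ℂ) = (Real.sin (oddFreq N * Real.pi * x) : ℂ) := by
  induction N with
  | zero => simp [powSum, expZ, oddFreq]
  | succ N ih =>
    have h : powSum 0 (N + 1) x = expZ (N + 1) x + expZ (-(N + 1)) x + powSum 0 N x := by
      unfold powSum
      push_cast
      rw [Finset.sum_Icc_succ_eq_add_endpoints]
      simp
    rw [h, add_mul, ih]
    have e1 : expZ (N + 1) x + expZ (-(N + 1)) x =
        ((2 * Real.cos (2 * Real.pi * (N + 1) * x) : ℝ) : ℂ) := by
      push_cast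
      rw [Complex.two_cos]
      unfold expZ
      congr 2 <;> (push_cast; ring)
    rw [e1, ← Complex.ofReal_mul, ← Complex.ofReal_add]
    congr 1
    have h1 : oddFreq (N + 1) * Real.pi * x = 2 * Real.pi * (N + 1) * x + Real.pi * x := by
      unfold oddFreq; push_cast; ring
    have h2 : oddFreq N * Real.pi * x = 2 * Real.pi * (N + 1) * x - Real.pi * x := by
      unfold oddFreq; ring
    rw [h1, h2, Real.sin_add, Real.sin_sub]
    ring

/-! ### The Dirichlet kernel as a rescaled sinc plus a bounded oscillating remainder -/

theorem sin_pi_mul_ne_zero {x : ℝ} (h0 : 0 < |x|) (h1 : |x| < 1) : Real.sin (Real.pi * x) ≠ 0 := by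
  rw [Ne, Real.sin_eq_zero_iff]
  rintro ⟨n, hn⟩
  have hx : (n : ℝ) = x := by
    have := Real.pi_pos.ne'
    field_simp at hn
    linarith
  rw [← hx] at h0 h1
  rw [← Int.cast_abs] at h0 h1
  have h2 : 0 < |n| := by exact_mod_cast h0
  have h3 : |n| < 1 := by exact_mod_cast h1
  omega

/-- The difference `1 / sin (πt) - 1 / (πt)`. -/
def sinRem (t : ℝ) : ℝ := 1 / Real.sin (Real.pi * t) - 1 / (Real.pi * t)

theorem measurable_sinRem : Measurable sinRem := by unfold sinRem; fun_prop

/-- The poles at 0 cancel. With `y = πt`, the bounds `y - sin y ≤ y³` and `sin y ≥ 0.6 y` give at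
most `y / 0.6 ≤ 1.575 / 0.6 < 3`. -/
theorem abs_sinRem_le {t : ℝ} (ht : |t| ≤ 1 / 2) : |sinRem t| ≤ 3 := by
  have main : ∀ t : ℝ, 0 < t → t ≤ 1 / 2 → |sinRem t| ≤ 3 := by
    intro t h0 h1
    unfold sinRem
    set y := Real.pi * t with hy
    have hy0 : 0 < y := by positivity
    have hy1 : y ≤ Real.pi / 2 := by rw [hy]; nlinarith [Real.pi_pos]
    have hsin : 2 / Real.pi * y ≤ Real.sin y := Real.mul_le_sin hy0.le hy1
    have hs0 : 0 < Real.sin y := lt_of_lt_of_le (by positivity) hsin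
    have hcube : y - Real.sin y ≤ y ^ 3 := by
      linarith [Real.sin_gt_sub_cube hy0, pow_pos hy0 3]
    have hle := Real.sin_le hy0.le
    have e : 1 / Real.sin y - 1 / y = (y - Real.sin y) / (Real.sin y * y) := by
      field_simp
    rw [e, abs_of_nonneg (div_nonneg (by linarith) (by positivity)), div_le_iff₀ (by positivity)]
    have hpi : Real.pi < 3.15 := Real.pi_lt_d2
    have hyb : y ≤ 1.575 := by linarith
    have h2 : 0.6 * y ≤ Real.sin y := by
      refine le_trans ?_ hsin
      gcongr
      rw [le_div_iff₀ Real.pi_pos]; linarith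
    nlinarith [mul_le_mul_of_nonneg_right h2 hy0.le, mul_nonneg hy0.le hy0.le,
      mul_nonneg (mul_nonneg hy0.le hy0.le) (sub_nonneg.2 hyb)]
  rcases lt_trichotomy t 0 with h | h | h
  · have := main (-t) (by linarith) (by rw [abs_of_neg h] at ht; exact ht)
    have e : sinRem (-t) = -sinRem t := by
      unfold sinRem
      rw [mul_neg, Real.sin_neg, div_neg, div_neg]; ring
    rwa [e, abs_neg] at this
  · simp [h, sinRem]
  · exact main t h (by rwa [abs_of_pos h] at ht)

/-- Isolates the part of the kernel that concentrates at scale `1/(2N+1)`; Riemann-Lebesgue can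
remove the other part. At `x = 0` the convention `1/0 = 0` makes `sinRem` vanish and both sides
equal `2N+1`. -/
theorem powSum_zero_eq {N : ℕ} {x : ℝ} (hx : |x| < 1) :
    powSum 0 N x = oddFreq N * sincPi (oddFreq N * x) +
      (Real.sin (oddFreq N * Real.pi * x) : ℂ) * (sinRem x : ℂ) := by
  rcases eq_or_ne x 0 with rfl | h0
  · have ht : ((N : ℤ) + 1 + N).toNat = 2 * N + 1 := by omega
    simp [powSum, expZ, sincPi, sinRem, oddFreq, ht]
  · have hs := sin_pi_mul_ne_zero (abs_pos.2 h0) hx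
    have hM := (oddFreq_pos N).ne'
    have hpi := Real.pi_pos.ne'
    have h1 : powSum 0 N x = ((Real.sin (oddFreq N * Real.pi * x) / Real.sin (Real.pi * x) : ℝ) : ℂ)
        := by
      rw [Complex.ofReal_div, eq_div_iff (by exact_mod_cast hs), powSum_zero_mul_sin]
    rw [h1, sincPi, Real.sinc_of_ne_zero (mul_ne_zero hpi (mul_ne_zero hM h0)), sinRem,
      ← Complex.ofReal_mul, ← Complex.ofReal_mul, ← Complex.ofReal_add]
    congr 1
    have e : Real.pi * (oddFreq N * x) = oddFreq N * Real.pi * x := by ring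
    rw [e]
    field_simp
    ring

/-! ### Partial sums of the Fourier series of the periodic Bernoulli functions -/

/-- The constant `-q! / (2πi)^q`. -/
def bernoulliConst (q : ℕ) : ℂ := -(q.factorial : ℂ) / (2 * Real.pi * Complex.I) ^ q

/-- The partial sums of the Fourier series of `periodicBernoulli q`. -/
def bernoulliPartial (q N : ℕ) (x : ℝ) : ℂ := bernoulliConst q * powSum q N x

theorem continuous_bernoulliPartial (q N : ℕ) : Continuous (bernoulliPartial q N) :=
  continuous_const.mul (continuous_powSum q N)

theorem bernoulliPartial_add_intCast (q N : ℕ) (x : ℝ) (m : ℤ) :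
    bernoulliPartial q N (x + m) = bernoulliPartial q N x := by
  simp [bernoulliPartial, powSum_add_intCast]

theorem bernoulliPartial_one_neg (N : ℕ) (x : ℝ) :
    bernoulliPartial 1 N (-x) = -bernoulliPartial 1 N x := by
  simp [bernoulliPartial, powSum_neg]

theorem bernoulliPartial_one_zero (N : ℕ) : bernoulliPartial 1 N 0 = 0 := by
  have h := bernoulliPartial_one_neg N 0
  rw [neg_zero] at h
  exact self_eq_neg.1 h

/-- Oddness and period 1 together force this zero, which makes `1/2` a base point for integrating `1
- D_N` at every `N`. -/
theorem bernoulliPartial_one_half (N : ℕ) : bernoulliPartial 1 N (1 / 2) = 0 := by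
  have h := bernoulliPartial_one_neg N (1 / 2)
  have h2 := bernoulliPartial_add_intCast 1 N (-(1 / 2)) 1
  rw [h, show (-(1 / 2) + ((1 : ℤ) : ℝ) : ℝ) = 1 / 2 by norm_num] at h2
  exact self_eq_neg.1 h2

theorem hasDerivAt_bernoulliPartial_one (N : ℕ) (x : ℝ) :
    HasDerivAt (bernoulliPartial 1 N) (1 - powSum 0 N x) x := by
  have h := (hasDerivAt_powSum_succ 0 N x).const_mul (bernoulliConst 1)
  convert! h using 1
  have := Complex.two_pi_I_ne_zero
  simp only [bernoulliConst, if_true, pow_one, Nat.factorial_one, Nat.cast_one]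
  field_simp
  ring

theorem hasDerivAt_bernoulliPartial_succ {q : ℕ} (hq : 1 ≤ q) (N : ℕ) (x : ℝ) :
    HasDerivAt (bernoulliPartial (q + 1) N) ((q + 1) * bernoulliPartial q N x) x := by
  have h := (hasDerivAt_powSum_succ q N x).const_mul (bernoulliConst (q + 1))
  convert! h using 1
  have := Complex.two_pi_I_ne_zero
  have hq0 : q ≠ 0 := by omega
  simp only [bernoulliPartial, bernoulliConst, hq0, if_false, Nat.factorial_succ, Nat.cast_mul,
    pow_succ]
  push_cast
  field_simp
  ring

/-- Gibbs phenomenon: integrate `1 - D_N` from 0 with the kernel split as in `powSum_zero_eq`. The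
sinc part integrates to `sineInt`; the rest is at most `|x| + 3|x|`, uniformly in `N`. -/
theorem bernoulliPartial_one_add_sineInt (N : ℕ) {x : ℝ} (hx : |x| ≤ 1 / 2) :
    ‖bernoulliPartial 1 N x + sineInt (oddFreq N * x)‖ ≤ 4 * |x| ∧
      bernoulliPartial 1 N x + sineInt (oddFreq N * x) =
        x - ∫ t in (0 : ℝ)..x, (Real.sin (oddFreq N * Real.pi * t) : ℂ) * (sinRem t : ℂ) := by
  have hft : ∫ t in (0 : ℝ)..x, (1 - powSum 0 N t) = bernoulliPartial 1 N x := by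
    rw [intervalIntegral.integral_eq_sub_of_hasDerivAt
      (fun t _ => hasDerivAt_bernoulliPartial_one N t)
      ((continuous_const.sub (continuous_powSum 0 N)).intervalIntegrable _ _),
      bernoulliPartial_one_zero, sub_zero]
  have hsc : Continuous fun t => (oddFreq N : ℂ) * sincPi (oddFreq N * t) :=
    continuous_const.mul (continuous_sincPi.comp (continuous_const.mul continuous_id))
  have hsi : ∫ t in (0 : ℝ)..x, (oddFreq N : ℂ) * sincPi (oddFreq N * t) =
      sineInt (oddFreq N * x) := by
    rw [intervalIntegral.integral_const_mul]
    have := intervalIntegral.smul_integral_comp_mul_left (a := 0) (b := x) sincPi (oddFreq N)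
    rw [mul_zero] at this
    rw [sineInt, ← this, Complex.real_smul]
  have hid : bernoulliPartial 1 N x + sineInt (oddFreq N * x) =
      x - ∫ t in (0 : ℝ)..x, (Real.sin (oddFreq N * Real.pi * t) : ℂ) * (sinRem t : ℂ) := by
    have hx' : (x : ℂ) = ∫ t in (0 : ℝ)..x, (1 : ℂ) := by simp
    have hDc : Continuous fun t => 1 - powSum 0 N t := continuous_const.sub (continuous_powSum 0 N)
    rw [hx', ← hft, ← hsi, ← intervalIntegral.integral_add (hDc.intervalIntegrable _ _)
      (hsc.intervalIntegrable _ _), eq_sub_iff_add_eq]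
    have hcongr : ∫ t in (0 : ℝ)..x, (Real.sin (oddFreq N * Real.pi * t) : ℂ) * (sinRem t : ℂ) =
        ∫ t in (0 : ℝ)..x, (powSum 0 N t - (oddFreq N : ℂ) * sincPi (oddFreq N * t)) := by
      refine intervalIntegral.integral_congr fun t ht => ?_
      have ht1 : |t| < 1 := by
        have h1 := abs_sub_left_of_mem_uIcc ht
        simp only [sub_zero] at h1
        linarith
      rw [powSum_zero_eq ht1]; ring
    rw [hcongr, ← intervalIntegral.integral_add]
    · congr 1; ext t; ring
    · exact (hDc.add hsc).intervalIntegrable _ _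
    · exact ((continuous_powSum 0 N).sub hsc).intervalIntegrable _ _
  refine ⟨?_, hid⟩
  rw [hid]
  have hb : ‖∫ t in (0 : ℝ)..x, (Real.sin (oddFreq N * Real.pi * t) : ℂ) * (sinRem t : ℂ)‖
      ≤ 3 * |x - 0| := by
    refine intervalIntegral.norm_integral_le_of_norm_le_const fun t ht => ?_
    have ht1 : |t| ≤ 1 / 2 := by
      have h1 := abs_sub_left_of_mem_uIcc (uIoc_subset_uIcc ht)
      simp only [sub_zero] at h1
      linarith
    rw [norm_mul, Complex.norm_real, Complex.norm_real]
    calc _ ≤ 1 * 3 := mul_le_mul (Real.abs_sin_le_one _) (abs_sinRem_le ht1) (abs_nonneg _)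
          zero_le_one
      _ = 3 := one_mul _
  refine (norm_sub_le _ _).trans ?_
  rw [Complex.norm_real, Real.norm_eq_abs]
  rw [sub_zero] at hb
  linarith

/-- Integrate `1 - D_N` from `1/2`. Between `1/2` and `x` the function `1 / sin(πt)` is bounded, so
Riemann-Lebesgue makes the kernel's integral vanish in the limit. -/
theorem tendsto_bernoulliPartial_one {x : ℝ} (h0 : 0 < x) (h1 : x < 1) :
    Tendsto (fun N => bernoulliPartial 1 N x) atTop (𝓝 (x - 1 / 2)) := by
  have key : ∀ a b : ℝ, 0 < a → b < 1 → a ≤ b →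
      Tendsto (fun N => ∫ t in a..b, powSum 0 N t) atTop (𝓝 0) := by
    intro a b ha hb hab
    have hpos : ∀ t ∈ Icc a b, 0 < Real.sin (Real.pi * t) := fun t ht =>
      Real.sin_pos_of_pos_of_lt_pi (mul_pos Real.pi_pos (ha.trans_le ht.1))
        (mul_lt_of_lt_one_right Real.pi_pos (ht.2.trans_lt hb))
    obtain ⟨t0, ht0, hmin⟩ := isCompact_Icc.exists_isMinOn (nonempty_Icc.2 hab)
      (f := fun t => Real.sin (Real.pi * t)) (by fun_prop)
    have h := tendsto_intervalIntegral_sin_mul (c := 1) one_pos hab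
      (A := fun _ t => (((Real.sin (Real.pi * t))⁻¹ : ℝ) : ℂ)) (C := (Real.sin (Real.pi * t0))⁻¹)
      (fun _ => by fun_prop) (fun N t ht => by
        have ht' := Ioc_subset_Icc_self ht
        rw [Complex.norm_real, Real.norm_eq_abs, abs_of_pos (inv_pos.2 (hpos t ht'))]
        exact inv_anti₀ (hpos t0 ht0) (hmin ht'))
      (fun t _ => ⟨_, tendsto_const_nhds⟩)
    refine h.congr fun N => intervalIntegral.integral_congr fun t ht => ?_
    rw [uIcc_of_le hab] at ht
    have hne : ((Real.sin (Real.pi * t) : ℝ) : ℂ) ≠ 0 := by exact_mod_cast (hpos t ht).ne'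
    simp only [one_mul]
    rw [← powSum_zero_mul_sin, Complex.ofReal_inv, mul_assoc, mul_inv_cancel₀ hne, mul_one]
  have key' : Tendsto (fun N => ∫ t in (1 / 2)..x, powSum 0 N t) atTop (𝓝 0) := by
    rcases le_total (1 / 2) x with h | h
    · exact key _ _ (by norm_num) h1 h
    · have := (key x (1 / 2) h0 (by norm_num) h).neg
      rw [neg_zero] at this
      exact this.congr fun N => (intervalIntegral.integral_symm _ _).symm
  have h := (tendsto_const_nhds (x := ((x : ℂ) - 1 / 2))).sub key'
  rw [sub_zero] at h
  refine h.congr fun N => ?_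
  have hD := continuous_powSum 0 N
  have hft := intervalIntegral.integral_eq_sub_of_hasDerivAt (a := 1 / 2) (b := x)
    (fun t _ => hasDerivAt_bernoulliPartial_one N t)
    ((continuous_const.sub hD).intervalIntegrable _ _)
  rw [bernoulliPartial_one_half, sub_zero, intervalIntegral.integral_sub
    (continuous_const.intervalIntegrable _ _) (hD.intervalIntegrable _ _)] at hft
  rw [← hft]
  simp

/-- Integration by parts gives existence of the limit. Its value is read off along `(2N+1)/4`, where
the Gibbs comparison at `x = 1/4` gives `1/4 - (1/4 - 1/2)`. -/
theorem tendsto_sineInt_atTop : Tendsto sineInt atTop (𝓝 (1 / 2)) := by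
  obtain ⟨l, hl⟩ := exists_tendsto_integral_sincPi_mul (c := 1) (C := 1) (C' := 0) one_pos
    (P := fun _ => 1) (P' := fun _ => 0) (fun u => hasDerivAt_const u 1) continuous_const
    (by simp) (by simp)
  simp only [one_mul, mul_one] at hl
  change Tendsto sineInt atTop (𝓝 l) at hl
  have h1 : Tendsto (fun N => sineInt (oddFreq N * (1 / 4))) atTop (𝓝 l) :=
    hl.comp (tendsto_oddFreq.atTop_mul_const (by norm_num))
  have h2 := tendsto_intervalIntegral_sin_mul (c := 1) (a := 0) (b := 1 / 4) (C := 3) one_pos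
    (by norm_num) (A := fun _ t => (sinRem t : ℂ))
    (fun _ => Complex.measurable_ofReal.comp measurable_sinRem)
    (fun N t ht => by
      rw [Complex.norm_real]
      exact abs_sinRem_le (by rw [abs_of_pos ht.1]; linarith [ht.2]))
    (fun t _ => ⟨_, tendsto_const_nhds⟩)
  simp only [one_mul] at h2
  have h3 : Tendsto (fun N => sineInt (oddFreq N * (1 / 4))) atTop (𝓝 (1 / 2)) := by
    have h4 := ((tendsto_const_nhds (x := (((1 / 4 : ℝ) : ℂ)))).sub h2).sub
      (tendsto_bernoulliPartial_one (x := 1 / 4) (by norm_num) (by norm_num))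
    have e : (((1 / 4 : ℝ) : ℂ)) - 0 - (((1 / 4 : ℝ) : ℂ) - 1 / 2) = 1 / 2 := by ring
    rw [e] at h4
    refine h4.congr fun N => ?_
    rw [← (bernoulliPartial_one_add_sineInt N (x := 1 / 4) (by norm_num [abs_of_pos])).2]
    ring
  rw [tendsto_nhds_unique h1 h3] at hl
  exact hl

theorem tendsto_sineInt_atBot : Tendsto sineInt atBot (𝓝 (-(1 / 2))) := by
  refine (tendsto_sineInt_atTop.comp tendsto_neg_atBot_atTop).neg.congr fun u => ?_
  simp [sineInt_neg]

theorem exists_norm_sineInt_le : ∃ C, ∀ u, ‖sineInt u‖ ≤ C := by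
  obtain ⟨A, hA⟩ := eventually_atTop.1
    (tendsto_sineInt_atTop.norm.eventually (gt_mem_nhds (lt_add_one _)))
  obtain ⟨C, hC⟩ := (isCompact_Icc (a := -|A|) (b := |A|)).exists_bound_of_continuousOn
    continuous_sineInt.continuousOn
  refine ⟨max C (‖(1 / 2 : ℂ)‖ + 1), fun u => ?_⟩
  rcases le_total |u| |A| with h | h
  · exact (hC u (abs_le.1 h)).trans (le_max_left _ _)
  · refine le_trans ?_ (le_max_right _ _)
    have h1 := (hA |u| ((le_abs_self A).trans h)).le
    rcases abs_choice u with h2 | h2 <;> rw [h2] at h1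
    · exact h1
    · rwa [sineInt_neg, norm_neg] at h1

/-- For `q ≥ 2` the Fourier series converges absolutely. For `q = 1` it does not; instead the
nearest integer is subtracted and the Gibbs comparison is used, with `4 · 1/2 = 2`. -/
theorem exists_norm_bernoulliPartial_le {q : ℕ} (hq : 1 ≤ q) :
    ∃ C, ∀ N x, ‖bernoulliPartial q N x‖ ≤ C := by
  rcases hq.eq_or_lt with rfl | hq
  · obtain ⟨C, hC⟩ := exists_norm_sineInt_le
    refine ⟨2 + C, fun N x => ?_⟩
    have e : bernoulliPartial 1 N x = bernoulliPartial 1 N (x - round x) := by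
      rw [← bernoulliPartial_add_intCast 1 N (x - round x) (round x), sub_add_cancel]
    have hx := abs_sub_round x
    have h := (bernoulliPartial_one_add_sineInt N (x := x - round x) hx).1
    rw [e]
    calc _ = ‖(bernoulliPartial 1 N (x - round x) + sineInt (oddFreq N * (x - round x))) -
          sineInt (oddFreq N * (x - round x))‖ := by rw [add_sub_cancel_right]
      _ ≤ _ := norm_sub_le _ _
      _ ≤ 2 + C := add_le_add (by linarith) (hC _)
  · have hs : Summable fun n : ℤ => 1 / |(n : ℝ)| ^ q := by
      have := (Real.summable_one_div_int_pow (p := q)).2 hq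
      simpa [abs_inv, abs_pow] using this.abs
    refine ⟨‖bernoulliConst q‖ * ∑' n : ℤ, 1 / |(n : ℝ)| ^ q, fun N x => ?_⟩
    rw [bernoulliPartial, norm_mul]
    gcongr
    unfold powSum
    refine (norm_sum_le _ _).trans (le_trans (Finset.sum_le_sum fun n _ => ?_)
      (hs.sum_le_tsum (Finset.Icc (-(N : ℤ)) N) fun n _ => by positivity))
    rw [norm_mul, norm_expZ, norm_inv, norm_pow, mul_one, Complex.norm_intCast, one_div]

theorem tendsto_Icc_neg_atTop :
    Tendsto (fun N : ℕ => Finset.Icc (-(N : ℤ)) N) atTop atTop := by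
  refine tendsto_atTop_finset_of_monotone (fun a b hab => ?_) fun n => ⟨n.natAbs, ?_⟩
  · exact Finset.Icc_subset_Icc (by omega) (by omega)
  · rw [Finset.mem_Icc]; omega

theorem tendsto_bernoulliPartial {q : ℕ} (hq : 1 ≤ q) {x : ℝ} (hx : q ≠ 1 ∨ Int.fract x ≠ 0) :
    Tendsto (fun N => bernoulliPartial q N x) atTop (𝓝 (periodicBernoulli q x)) := by
  have e : ∀ N, bernoulliPartial q N x = bernoulliPartial q N (Int.fract x) := fun N => by
    rw [← bernoulliPartial_add_intCast q N (Int.fract x) ⌊x⌋, Int.fract_add_floor]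
  simp only [e]
  by_cases h1 : q = 1
  · subst h1
    have hf : Int.fract x ≠ 0 := by simpa using hx
    have := tendsto_bernoulliPartial_one (lt_of_le_of_ne (Int.fract_nonneg x) hf.symm)
      (Int.fract_lt_one x)
    simpa [periodicBernoulli, bernoulliFun_one] using this
  · have hs := hasSum_one_div_pow_mul_fourier_mul_bernoulliFun (k := q) (by omega)
      (x := Int.fract x) ⟨Int.fract_nonneg x, (Int.fract_lt_one x).le⟩
    have h := (hs.comp tendsto_Icc_neg_atTop).const_mul (bernoulliConst q)
    have e2 : bernoulliConst q * (-(2 * Real.pi * Complex.I) ^ q / (q.factorial : ℂ) *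
        (bernoulliFun q (Int.fract x) : ℂ)) = periodicBernoulli q x := by
      have := Complex.two_pi_I_ne_zero
      have h3 : (q.factorial : ℂ) ≠ 0 := by exact_mod_cast q.factorial_ne_zero
      unfold bernoulliConst periodicBernoulli
      field_simp
    rw [e2] at h
    refine h.congr fun N => ?_
    simp only [Function.comp_apply, bernoulliPartial, powSum]
    congr 1
    refine Finset.sum_congr rfl fun n _ => ?_
    rw [one_div, fourier_coe_apply, expZ]
    simp

theorem exists_tendsto_bernoulliPartial {q : ℕ} (hq : 1 ≤ q) (x : ℝ) :
    ∃ l, Tendsto (fun N => bernoulliPartial q N x) atTop (𝓝 l) := by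
  by_cases h : q ≠ 1 ∨ Int.fract x ≠ 0
  · exact ⟨_, tendsto_bernoulliPartial hq h⟩
  · push Not at h
    obtain ⟨rfl, hf⟩ := h
    -- At integers the partial sums are all 0, whereas `periodicBernoulli 1` equals `-1/2` there.
    refine ⟨0, tendsto_const_nhds.congr fun N => ?_⟩
    rw [← bernoulliPartial_one_zero N, ← bernoulliPartial_add_intCast 1 N 0 ⌊x⌋, zero_add]
    congr 1
    rw [Int.fract, sub_eq_zero] at hf
    exact hf.symm

/-- The derivative is a multiple of the partial sum of order `q - 1`, which is bounded uniformly in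
`N`. -/
theorem exists_lipschitz_bernoulliPartial {q : ℕ} (hq : 2 ≤ q) :
    ∃ C, ∀ N x y, ‖bernoulliPartial q N x - bernoulliPartial q N y‖ ≤ C * |x - y| := by
  obtain ⟨p, rfl⟩ : ∃ p, q = p + 1 := ⟨q - 1, by omega⟩
  obtain ⟨C, hC⟩ := exists_norm_bernoulliPartial_le (q := p) (by omega)
  refine ⟨(p + 1) * C, fun N x y => ?_⟩
  refine Convex.norm_image_sub_le_of_norm_hasDerivWithin_le (s := univ)
    (fun t _ => (hasDerivAt_bernoulliPartial_succ (q := p) (by omega) N t).hasDerivWithinAt)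
    (fun t _ => ?_) convex_univ (mem_univ y) (mem_univ x)
  rw [norm_mul]
  have : ‖((p : ℂ) + 1)‖ = p + 1 := by
    have := Complex.norm_natCast (p + 1); push_cast at this; exact this
  rw [this]
  gcongr
  exact hC N t

/-- The derivative is `1 - D_N`, and `|D_N(t)| ≤ 1 / |sin(πt)|` is bounded near a non-integer. -/
theorem exists_lipschitz_bernoulliPartial_one {y : ℝ} (hy : Int.fract y ≠ 0) :
    ∃ δ > 0, ∃ C, ∀ N x, |x - y| ≤ δ →
      ‖bernoulliPartial 1 N x - bernoulliPartial 1 N y‖ ≤ C * |x - y| := by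
  have hsy : Real.sin (Real.pi * y) ≠ 0 := by
    rw [Ne, Real.sin_eq_zero_iff]
    rintro ⟨n, hn⟩
    have : (n : ℝ) = y := by
      have := Real.pi_pos.ne'
      field_simp at hn
      linarith
    rw [← this, Int.fract_intCast] at hy
    exact hy rfl
  have hcont : ContinuousAt (fun t : ℝ => |(Real.sin (Real.pi * t))|) y := by fun_prop
  set m := |Real.sin (Real.pi * y)| / 2 with hm
  have hm0 : 0 < m := by positivity
  have hev := hcont.eventually (lt_mem_nhds (show m < |Real.sin (Real.pi * y)| by
    have := abs_pos.2 hsy; linarith))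
  obtain ⟨δ, hδ, hball⟩ := Metric.eventually_nhds_iff_ball.1 hev
  refine ⟨δ / 2, by positivity, 1 + 1 / m, fun N x hx => ?_⟩
  have hsub : Metric.closedBall y (δ / 2) ⊆ Metric.ball y δ :=
    Metric.closedBall_subset_ball (by linarith)
  refine Convex.norm_image_sub_le_of_norm_hasDerivWithin_le (s := Metric.closedBall y (δ / 2))
    (fun t _ => (hasDerivAt_bernoulliPartial_one N t).hasDerivWithinAt)
    (fun t ht => ?_) (convex_closedBall _ _) (Metric.mem_closedBall_self (by positivity))
    (by rwa [Metric.mem_closedBall, Real.dist_eq])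
  have hmt := hball t (hsub ht)
  refine (norm_sub_le _ _).trans (add_le_add (by simp) ?_)
  rw [le_div_iff₀ hm0]
  calc ‖powSum 0 N t‖ * m ≤ ‖powSum 0 N t‖ * |Real.sin (Real.pi * t)| := by gcongr
    _ = ‖powSum 0 N t * (Real.sin (Real.pi * t) : ℂ)‖ := by
      rw [norm_mul, Complex.norm_real, Real.norm_eq_abs]
    _ ≤ 1 := by
      rw [powSum_zero_mul_sin, Complex.norm_real]; exact Real.abs_sin_le_one _

/-! ### Localization of Dirichlet integrals -/

/-- Sequences of continuous functions which are uniformly bounded and pointwise convergent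
on `[-a, a]`. -/
structure Tame (a : ℝ) (f : ℕ → ℝ → ℂ) : Prop where
  cont : ∀ N, Continuous (f N)
  bdd : ∃ C, ∀ N x, |x| ≤ a → ‖f N x‖ ≤ C
  conv : ∀ x, |x| ≤ a → ∃ l, Tendsto (fun N => f N x) atTop (𝓝 l)

/-- Tame sequences whose difference is `O(|x|)` on `[-a, a]`, uniformly in the index. -/
structure Near (a : ℝ) (f g : ℕ → ℝ → ℂ) : Prop where
  left : Tame a f
  right : Tame a g
  near : ∃ C, ∀ N x, |x| ≤ a → ‖f N x - g N x‖ ≤ C * |x|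

theorem Tame.const {a : ℝ} {u : ℕ → ℂ} {l : ℂ} (hu : Tendsto u atTop (𝓝 l)) :
    Tame a fun N _ => u N := by
  obtain ⟨C, hC⟩ := hu.norm.bddAbove_range
  exact ⟨fun N => continuous_const, ⟨C, fun N _ _ => hC ⟨N, rfl⟩⟩, fun _ _ => ⟨l, hu⟩⟩

theorem Tame.mul {a : ℝ} {f g : ℕ → ℝ → ℂ} (hf : Tame a f) (hg : Tame a g) :
    Tame a fun N x => f N x * g N x := by
  obtain ⟨C, hC⟩ := hf.bdd
  obtain ⟨C', hC'⟩ := hg.bdd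
  refine ⟨fun N => (hf.cont N).mul (hg.cont N), ⟨C * C', fun N x hx => ?_⟩, fun x hx => ?_⟩
  · rw [norm_mul]
    exact mul_le_mul (hC N x hx) (hC' N x hx) (norm_nonneg _) ((norm_nonneg _).trans (hC N x hx))
  · obtain ⟨l, hl⟩ := hf.conv x hx
    obtain ⟨l', hl'⟩ := hg.conv x hx
    exact ⟨_, hl.mul hl'⟩

theorem Tame.sub {a : ℝ} {f g : ℕ → ℝ → ℂ} (hf : Tame a f) (hg : Tame a g) :
    Tame a fun N x => f N x - g N x := by
  obtain ⟨C, hC⟩ := hf.bdd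
  obtain ⟨C', hC'⟩ := hg.bdd
  refine ⟨fun N => (hf.cont N).sub (hg.cont N), ⟨C + C', fun N x hx => ?_⟩, fun x hx => ?_⟩
  · exact (norm_sub_le _ _).trans (add_le_add (hC N x hx) (hC' N x hx))
  · obtain ⟨l, hl⟩ := hf.conv x hx
    obtain ⟨l', hl'⟩ := hg.conv x hx
    exact ⟨_, hl.sub hl'⟩

theorem Near.mul {a : ℝ} {f g f' g' : ℕ → ℝ → ℂ} (h : Near a f g) (h' : Near a f' g') :
    Near a (fun N x => f N x * f' N x) fun N x => g N x * g' N x := by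
  refine ⟨h.left.mul h'.left, h.right.mul h'.right, ?_⟩
  obtain ⟨B, hB⟩ := h.left.bdd
  obtain ⟨B', hB'⟩ := h'.right.bdd
  obtain ⟨C, hC⟩ := h.near
  obtain ⟨C', hC'⟩ := h'.near
  refine ⟨B * C' + C * B', fun N x hx => ?_⟩
  have e : f N x * f' N x - g N x * g' N x =
      f N x * (f' N x - g' N x) + (f N x - g N x) * g' N x := by ring
  rw [e]
  refine (norm_add_le _ _).trans ?_
  rw [norm_mul, norm_mul]
  have h1 := mul_le_mul (hB N x hx) (hC' N x hx) (norm_nonneg _)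
    ((norm_nonneg _).trans (hB N x hx))
  have h2 := mul_le_mul (hC N x hx) (hB' N x hx) (norm_nonneg _)
    ((norm_nonneg _).trans (hC N x hx))
  linarith

theorem Near.prod {ι : Type*} {a : ℝ} (s : Finset ι) {f g : ι → ℕ → ℝ → ℂ}
    (h : ∀ i ∈ s, Near a (f i) (g i)) :
    Near a (fun N x => ∏ i ∈ s, f i N x) fun N x => ∏ i ∈ s, g i N x := by
  classical
  induction s using Finset.induction_on with
  | empty =>
    have := Tame.const (a := a) (tendsto_const_nhds (x := (1 : ℂ)) (f := atTop (α := ℕ)))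
    simpa using (⟨this, this, 0, by simp⟩ : Near a (fun _ _ => 1) fun _ _ => 1)
  | insert i s hi ih =>
    have := (h i (Finset.mem_insert_self _ _)).mul
      (ih fun j hj => h j (Finset.mem_insert_of_mem hj))
    simpa only [Finset.prod_insert hi] using this

/-- Uniform closeness near `0` suffices. -/
theorem Near.of_local {a δ C : ℝ} {f g : ℕ → ℝ → ℂ} (hf : Tame a f) (hg : Tame a g) (hδ : 0 < δ)
    (h : ∀ N x, |x| ≤ δ → ‖f N x - g N x‖ ≤ C * |x|) : Near a f g := by
  refine ⟨hf, hg, ?_⟩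
  obtain ⟨B, hB⟩ := (hf.sub hg).bdd
  refine ⟨max C (B / δ), fun N x hx => ?_⟩
  rcases le_total |x| δ with h1 | h1
  · exact (h N x h1).trans (by gcongr; exact le_max_left _ _)
  · have hB0 : 0 ≤ B := (norm_nonneg _).trans (hB N x hx)
    calc _ ≤ B := hB N x hx
      _ = B / δ * δ := by field_simp
      _ ≤ max C (B / δ) * |x| := by
        gcongr
        exact le_max_right _ _

theorem two_mul_abs_le_abs_sin {y : ℝ} (hy : |y| ≤ 1 / 2) : 2 * |y| ≤ |Real.sin (Real.pi * y)| := by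
  have hpi := Real.pi_pos
  have h := Real.mul_abs_le_abs_sin (x := Real.pi * y) (by
    rw [abs_mul, abs_of_pos hpi]; nlinarith)
  rw [abs_mul, abs_of_pos hpi] at h
  calc _ = 2 / Real.pi * (Real.pi * |y|) := by field_simp
    _ ≤ _ := h

/-- The `O(|x|)` bound on `E` cancels the pole of `1 / sin(πcx)` at 0, the only one in range since
`ca ≤ 1/2`. What multiplies the oscillating numerator is bounded by `|C|/(2c)`, because `|sin(πcx)|
≥ 2c|x|`. -/
theorem tendsto_integral_dirichlet_mul_of_le {a c C : ℝ} (hc : 0 < c) (ha : 0 ≤ a)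
    (hac : c * a ≤ 1 / 2) {E : ℕ → ℝ → ℂ} (hE : Tame a E)
    (hEC : ∀ N x, |x| ≤ a → ‖E N x‖ ≤ C * |x|) :
    Tendsto (fun N => ∫ x in (-a)..a, powSum 0 N (c * x) * E N x) atTop (𝓝 0) := by
  have hcx : ∀ x, |x| ≤ a → |c * x| ≤ 1 / 2 := fun x hx => by
    rw [abs_mul, abs_of_pos hc]
    exact (mul_le_mul_of_nonneg_left hx hc.le).trans hac
  have h := tendsto_intervalIntegral_sin_mul (a := -a) (b := a) (c := c) (C := |C| / (2 * c)) hc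
    (by linarith)
    (A := fun N x => E N x * (((Real.sin (Real.pi * (c * x)))⁻¹ : ℝ) : ℂ))
    (fun N => (hE.cont N).measurable.mul (by fun_prop))
    (fun N x hx => by
      have hx' : |x| ≤ a := abs_le.2 ⟨hx.1.le, hx.2⟩
      rw [norm_mul, Complex.norm_real, norm_inv, Real.norm_eq_abs]
      rcases eq_or_ne x 0 with rfl | h0
      · simp; positivity
      · have hxp : 0 < |x| := abs_pos.2 h0
        have h1 := two_mul_abs_le_abs_sin (hcx x hx')
        rw [abs_mul, abs_of_pos hc] at h1
        have h2 : 0 < 2 * (c * |x|) := by positivity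
        rw [← div_eq_mul_inv, div_le_div_iff₀ (h2.trans_le h1) (by positivity)]
        calc ‖E N x‖ * (2 * c) ≤ (|C| * |x|) * (2 * c) := by
              gcongr
              exact (hEC N x hx').trans (by gcongr; exact le_abs_self _)
          _ = |C| * (2 * (c * |x|)) := by ring
          _ ≤ _ := by gcongr)
    (fun x hx => by
      obtain ⟨l, hl⟩ := hE.conv x (abs_le.2 ⟨hx.1.le, hx.2⟩)
      exact ⟨_, hl.mul_const _⟩)
  refine h.congr fun N => intervalIntegral.integral_congr fun x hx => ?_
  rw [uIcc_of_le (by linarith)] at hx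
  have hx' : |x| ≤ a := abs_le.2 hx
  rcases eq_or_ne x 0 with rfl | h0
  · have := hEC N 0 hx'
    rw [abs_zero, mul_zero, norm_le_zero_iff] at this
    simp [this]
  · have hne : ((Real.sin (Real.pi * (c * x)) : ℝ) : ℂ) ≠ 0 := by
      exact_mod_cast sin_pi_mul_ne_zero (abs_pos.2 (mul_ne_zero hc.ne' h0))
        (lt_of_le_of_lt (hcx x hx') (by norm_num))
    rw [← powSum_zero_mul_sin, Complex.ofReal_inv]
    generalize ((Real.sin (Real.pi * (c * x)) : ℝ) : ℂ) = s at hne ⊢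
    field_simp

theorem integral_dirichlet {a c : ℝ} (hc : 0 < c) (hac : c * a = 1 / 2) (N : ℕ) :
    ∫ x in (-a)..a, powSum 0 N (c * x) = 1 / c := by
  have hD := continuous_powSum 0 N
  have h := intervalIntegral.smul_integral_comp_mul_left (a := -a) (b := a) (powSum 0 N) c
  rw [mul_neg, hac] at h
  have hft := intervalIntegral.integral_eq_sub_of_hasDerivAt (a := -(1 / 2)) (b := 1 / 2)
    (fun t _ => hasDerivAt_bernoulliPartial_one N t)
    ((continuous_const.sub hD).intervalIntegrable _ _)
  rw [bernoulliPartial_one_neg, bernoulliPartial_one_half, intervalIntegral.integral_sub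
    (continuous_const.intervalIntegrable _ _) (hD.intervalIntegrable _ _)] at hft
  have h1 : ∫ x in (-(1 / 2 : ℝ))..(1 / 2), powSum 0 N x = 1 := by
    have h2 : ∫ x in (-(1 / 2 : ℝ))..(1 / 2), (1 : ℂ) = 1 := by simp; norm_num
    rw [h2, neg_zero, sub_zero, sub_eq_zero] at hft
    exact hft.symm
  rw [h1, Complex.real_smul] at h
  have : (c : ℂ) ≠ 0 := by exact_mod_cast hc.ne'
  field_simp
  rw [mul_comm]
  exact h

theorem tendsto_integral_dirichlet_mul_of_near_const {a c : ℝ} (hc : 0 < c) (hac : c * a = 1 / 2)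
    {F : ℕ → ℝ → ℂ} {u : ℕ → ℂ} {l : ℂ} (hu : Tendsto u atTop (𝓝 l))
    (hF : Near a F fun N _ => u N) :
    Tendsto (fun N => ∫ x in (-a)..a, powSum 0 N (c * x) * F N x) atTop (𝓝 (l / c)) := by
  have ha : 0 < a := by
    by_contra! h
    nlinarith
  obtain ⟨C, hC⟩ := hF.near
  have h := (tendsto_integral_dirichlet_mul_of_le hc ha.le hac.le (hF.left.sub hF.right) hC).add
    (hu.div_const (c : ℂ))
  rw [zero_add] at h
  refine h.congr fun N => ?_
  have hD : Continuous fun x => powSum 0 N (c * x) :=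
    (continuous_powSum 0 N).comp (continuous_const.mul continuous_id)
  have e : u N / c = ∫ x in (-a)..a, powSum 0 N (c * x) * u N := by
    rw [intervalIntegral.integral_mul_const, integral_dirichlet hc hac]; ring
  rw [e, ← intervalIntegral.integral_add]
  · congr 1; ext x; ring
  · exact (hD.mul ((hF.left.sub hF.right).cont N)).intervalIntegrable _ _
  · exact (hD.mul continuous_const).intervalIntegrable _ _

/-- Here `F` varies at the scale of the kernel, so no point value can be extracted. The sinc part of
the kernel, after `t = (2N+1)x`, becomes the truncated integral defining `T`; the `sinRem` part and
the `O(|x|)` error vanish by Riemann-Lebesgue. -/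
theorem tendsto_integral_dirichlet_mul_of_near_scaled {a c : ℝ} (hc : 0 < c) (hac : c * a = 1 / 2)
    {F : ℕ → ℝ → ℂ} {u : ℕ → ℂ} {l T : ℂ} (hu : Tendsto u atTop (𝓝 l)) {H : ℝ → ℂ}
    (hH : Tame a fun N x => H (oddFreq N * x))
    (hF : Near a F fun N x => u N * H (oddFreq N * x))
    (hT : Tendsto (fun A : ℝ => ∫ t in (-A)..A, sincPi (c * t) * H t) atTop (𝓝 T)) :
    Tendsto (fun N => ∫ x in (-a)..a, powSum 0 N (c * x) * F N x) atTop (𝓝 (l * T)) := by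
  have ha : 0 < a := by
    by_contra! h
    nlinarith
  have hcx : ∀ x, |x| ≤ a → |c * x| ≤ 1 / 2 := fun x hx => by
    rw [abs_mul, abs_of_pos hc, ← hac]
    exact mul_le_mul_of_nonneg_left hx hc.le
  obtain ⟨C, hC⟩ := hF.near
  have h1 := tendsto_integral_dirichlet_mul_of_le hc ha.le hac.le (hF.left.sub hF.right) hC
  obtain ⟨B, hB⟩ := hH.bdd
  have h2 := tendsto_intervalIntegral_sin_mul (a := -a) (b := a) (c := c) (C := 3 * B) hc
    (by linarith) (A := fun N x => (sinRem (c * x) : ℂ) * H (oddFreq N * x))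
    (fun N => (Complex.measurable_ofReal.comp
      (measurable_sinRem.comp (measurable_const_mul c))).mul (hH.cont N).measurable)
    (fun N x hx => by
      have hx' : |x| ≤ a := abs_le.2 ⟨hx.1.le, hx.2⟩
      rw [norm_mul, Complex.norm_real]
      exact mul_le_mul (abs_sinRem_le (hcx x hx')) (hB N x hx') (norm_nonneg _) (by norm_num))
    (fun x hx => by
      obtain ⟨l, hl⟩ := hH.conv x (abs_le.2 ⟨hx.1.le, hx.2⟩)
      exact ⟨_, hl.const_mul _⟩)
  have h3 := hT.comp (tendsto_oddFreq.atTop_mul_const ha)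
  have h4 := (h1.add (hu.mul h2)).add (hu.mul h3)
  rw [mul_zero, add_zero, zero_add] at h4
  refine h4.congr fun N => ?_
  have hD : Continuous fun x => powSum 0 N (c * x) :=
    (continuous_powSum 0 N).comp (continuous_const.mul continuous_id)
  have hS : Continuous fun x : ℝ => (oddFreq N : ℂ) * (sincPi (c * (oddFreq N * x)) *
      H (oddFreq N * x)) :=
    continuous_const.mul ((continuous_sincPi.comp (by fun_prop)).mul (hH.cont N))
  have e3 : ((fun A : ℝ => ∫ t in (-A)..A, sincPi (c * t) * H t) ∘ fun N => oddFreq N * a) N =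
      ∫ x in (-a)..a, (oddFreq N : ℂ) * (sincPi (c * (oddFreq N * x)) * H (oddFreq N * x)) := by
    have := intervalIntegral.smul_integral_comp_mul_left (a := -a) (b := a)
      (fun t => sincPi (c * t) * H t) (oddFreq N)
    rw [Complex.real_smul] at this
    rw [intervalIntegral.integral_const_mul, this, Function.comp_apply, mul_neg]
  have e2 : ∫ x in (-a)..a, (Real.sin (oddFreq N * Real.pi * (c * x)) : ℂ) *
      ((sinRem (c * x) : ℂ) * H (oddFreq N * x)) =
      ∫ x in (-a)..a, (powSum 0 N (c * x) * H (oddFreq N * x) -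
        (oddFreq N : ℂ) * (sincPi (c * (oddFreq N * x)) * H (oddFreq N * x))) := by
    refine intervalIntegral.integral_congr fun x hx => ?_
    rw [uIcc_of_le (by linarith)] at hx
    have e : c * (oddFreq N * x) = oddFreq N * (c * x) := by ring
    rw [powSum_zero_eq (lt_of_le_of_lt (hcx x (abs_le.2 hx)) (by norm_num)), e]
    ring
  rw [e3, e2, ← intervalIntegral.integral_const_mul, ← intervalIntegral.integral_const_mul,
    ← intervalIntegral.integral_add, ← intervalIntegral.integral_add]
  · congr 1; ext x; ring
  · exact ((hD.mul ((hF.left.sub hF.right).cont N)).add (continuous_const.mul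
      ((hD.mul (hH.cont N)).sub hS))).intervalIntegrable _ _
  · exact (continuous_const.mul hS).intervalIntegrable _ _
  · exact (hD.mul ((hF.left.sub hF.right).cont N)).intervalIntegrable _ _
  · exact (continuous_const.mul ((hD.mul (hH.cont N)).sub hS)).intervalIntegrable _ _

/-! ### Products of sine integrals -/

/-- Bounded continuously differentiable functions `P` with `P' = O(1/u)`. -/
structure SlowlyVarying (P P' : ℝ → ℂ) : Prop where
  deriv : ∀ u, HasDerivAt P (P' u) u
  cont : Continuous P'
  bdd : ∃ C, ∀ u, ‖P u‖ ≤ C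
  bdd_deriv : ∃ C, ∀ u, ‖P' u‖ * |u| ≤ C

theorem SlowlyVarying.mul {P P' Q Q' : ℝ → ℂ} (hP : SlowlyVarying P P')
    (hQ : SlowlyVarying Q Q') :
    SlowlyVarying (fun u => P u * Q u) fun u => P' u * Q u + P u * Q' u := by
  obtain ⟨C, hC⟩ := hP.bdd
  obtain ⟨D, hD⟩ := hQ.bdd
  obtain ⟨C', hC'⟩ := hP.bdd_deriv
  obtain ⟨D', hD'⟩ := hQ.bdd_deriv
  have hPc : Continuous P := continuous_iff_continuousAt.2 fun u => (hP.deriv u).continuousAt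
  have hQc : Continuous Q := continuous_iff_continuousAt.2 fun u => (hQ.deriv u).continuousAt
  refine ⟨fun u => (hP.deriv u).mul (hQ.deriv u), (hP.cont.mul hQc).add (hPc.mul hQ.cont),
    ⟨C * D, fun u => ?_⟩, ⟨C' * D + C * D', fun u => ?_⟩⟩
  · rw [norm_mul]
    exact mul_le_mul (hC u) (hD u) (norm_nonneg _) ((norm_nonneg _).trans (hC u))
  · have h1 := mul_le_mul (hC' u) (hD u) (norm_nonneg _)
      ((mul_nonneg (norm_nonneg _) (abs_nonneg _)).trans (hC' u))
    have h2 := mul_le_mul (hC u) (hD' u) (mul_nonneg (norm_nonneg _) (abs_nonneg _))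
      ((norm_nonneg _).trans (hC u))
    have h3 := mul_le_mul_of_nonneg_right (norm_add_le (P' u * Q u) (P u * Q' u)) (abs_nonneg u)
    rw [norm_mul, norm_mul] at h3
    linarith

theorem SlowlyVarying.exists_prod {ι : Type*} (s : Finset ι) {P P' : ι → ℝ → ℂ}
    (h : ∀ i ∈ s, SlowlyVarying (P i) (P' i)) :
    ∃ Q, SlowlyVarying (fun u => ∏ i ∈ s, P i u) Q := by
  classical
  induction s using Finset.induction_on with
  | empty =>
    exact ⟨fun _ => 0, by simpa using hasDerivAt_const (c := (1 : ℂ)), continuous_const,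
      ⟨1, by simp⟩, ⟨0, by simp⟩⟩
  | insert i s hi ih =>
    obtain ⟨Q, hQ⟩ := ih fun j hj => h j (Finset.mem_insert_of_mem hj)
    have := (h i (Finset.mem_insert_self _ _)).mul hQ
    simp only [Finset.prod_insert hi]
    exact ⟨_, this⟩

theorem SlowlyVarying.comp_neg {P P' : ℝ → ℂ} (h : SlowlyVarying P P') :
    SlowlyVarying (fun u => P (-u)) fun u => -P' (-u) := by
  obtain ⟨C, hC⟩ := h.bdd
  obtain ⟨C', hC'⟩ := h.bdd_deriv
  refine ⟨fun u => ?_, (h.cont.comp continuous_neg).neg, ⟨C, fun u => hC _⟩,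
    ⟨C', fun u => ?_⟩⟩
  · have := (h.deriv (-u)).scomp u (hasDerivAt_neg u)
    rw [neg_one_smul] at this
    exact this
  · simpa using hC' (-u)

theorem SlowlyVarying.exists_tendsto {P P' : ℝ → ℂ} (h : SlowlyVarying P P') {c : ℝ}
    (hc : 0 < c) :
    ∃ T, Tendsto (fun A : ℝ => ∫ t in (-A)..A, sincPi (c * t) * P t) atTop (𝓝 T) := by
  have key : ∀ {P P' : ℝ → ℂ}, SlowlyVarying P P' →
      ∃ T, Tendsto (fun A : ℝ => ∫ t in (0 : ℝ)..A, sincPi (c * t) * P t) atTop (𝓝 T) := by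
    intro P P' h
    obtain ⟨C, hC⟩ := h.bdd
    obtain ⟨C', hC'⟩ := h.bdd_deriv
    refine exists_tendsto_integral_sincPi_mul hc h.deriv h.cont (fun u _ => hC u) (C' := C')
      fun u hu => ?_
    rw [le_div_iff₀ hu]
    simpa [abs_of_pos hu] using hC' u
  obtain ⟨T, hT⟩ := key h
  obtain ⟨T', hT'⟩ := key h.comp_neg
  -- The half-line integrals converge separately; the negative one is reflected, sinc being even.
  refine ⟨T' + T, (hT'.add hT).congr fun A => ?_⟩
  have hPc : Continuous P := continuous_iff_continuousAt.2 fun u => (h.deriv u).continuousAt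
  have hcont : Continuous fun t => sincPi (c * t) * P t :=
    (continuous_sincPi.comp (continuous_const.mul continuous_id)).mul hPc
  rw [← intervalIntegral.integral_add_adjacent_intervals (hcont.intervalIntegrable (-A) 0)
    (hcont.intervalIntegrable 0 A)]
  congr 1
  have := intervalIntegral.integral_comp_neg (a := 0) (b := A) fun t => sincPi (c * t) * P t
  rw [neg_zero] at this
  rw [← this]
  simp only [mul_neg, sincPi_neg]

theorem hasDerivAt_neg_sineInt_mul (c u : ℝ) :
    HasDerivAt (fun u => -sineInt (c * u)) (-(c * sincPi (c * u))) u := by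
  have h := ((hasDerivAt_sineInt (c * u)).scomp u ((hasDerivAt_id u).const_mul c)).neg
  rw [mul_one, Complex.real_smul] at h
  exact h

theorem slowlyVarying_neg_sineInt {c : ℝ} (hc : 0 < c) :
    SlowlyVarying (fun u => -sineInt (c * u)) fun u => -(c * sincPi (c * u)) := by
  obtain ⟨C, hC⟩ := exists_norm_sineInt_le
  refine ⟨hasDerivAt_neg_sineInt_mul c, ?_, ⟨C, fun u => ?_⟩, ⟨1, fun u => ?_⟩⟩
  · exact (continuous_const.mul (continuous_sincPi.comp (continuous_const.mul continuous_id))).neg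
  · rw [norm_neg]; exact hC _
  · have key : ∀ v : ℝ, 0 < v → ‖-(c * sincPi (c * v))‖ * |v| ≤ 1 := by
      intro v hv
      rw [norm_neg, norm_mul, Complex.norm_real, Real.norm_eq_abs, abs_of_pos hc, abs_of_pos hv]
      calc _ ≤ c * (1 / (c * v)) * v := by
            gcongr
            exact norm_sincPi_le (by positivity)
        _ = 1 := by field_simp
    rcases lt_trichotomy u 0 with h | rfl | h
    · have := key (-u) (by linarith)
      rwa [mul_neg, sincPi_neg, abs_neg] at this
    · simp
    · exact key u h

/-- The summands are, up to sign, the terms of the product rule for `∏ (-sineInt (c_j t))`. Their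
sum is thus a difference of boundary values, tending to `∏ (1/2) - ∏ (-1/2)`. -/
theorem tendsto_sum_integral_sincPi_mul_prod {ι : Type*} [DecidableEq ι] (s : Finset ι)
    {c : ι → ℝ} (hc : ∀ i, 0 < c i) :
    Tendsto (fun A : ℝ => ∑ k ∈ s, (c k : ℂ) * ∫ t in (-A)..A, sincPi (c k * t) *
      ∏ j ∈ s.erase k, -sineInt (c j * t)) atTop
      (𝓝 ((1 - (-1) ^ s.card) / 2 ^ s.card)) := by
  have hlim : Tendsto (fun A : ℝ => ∏ j ∈ s, -sineInt (c j * -A) - ∏ j ∈ s, -sineInt (c j * A))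
      atTop (𝓝 (∏ _j ∈ s, (1 / 2) - ∏ _j ∈ s, -(1 / 2))) := by
    refine Tendsto.sub (tendsto_finsetProd _ fun j _ => ?_) (tendsto_finsetProd _ fun j _ => ?_)
    · have := tendsto_sineInt_atTop.comp (tendsto_id.const_mul_atTop (hc j))
      refine this.congr fun A => ?_
      simp [sineInt_neg]
    · exact (tendsto_sineInt_atTop.comp (tendsto_id.const_mul_atTop (hc j))).neg
  have e : ∏ _j ∈ s, (1 / 2 : ℂ) - ∏ _j ∈ s, -(1 / 2 : ℂ) =
      (1 - (-1) ^ s.card) / 2 ^ s.card := by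
    rw [Finset.prod_const, Finset.prod_const, neg_pow (1 / 2 : ℂ), one_div, inv_pow]
    ring
  rw [e] at hlim
  refine hlim.congr fun A => ?_
  have hd : ∀ t, HasDerivAt (fun t => ∏ j ∈ s, -sineInt (c j * t))
      (∑ k ∈ s, (∏ j ∈ s.erase k, -sineInt (c j * t)) • -(c k * sincPi (c k * t))) t := fun t =>
    HasDerivAt.fun_finsetProd fun j _ => hasDerivAt_neg_sineInt_mul (c j) t
  have hs : ∀ j, Continuous fun t => -sineInt (c j * t) := fun j =>
    (continuous_sineInt.comp (continuous_const.mul continuous_id)).neg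
  have hk : ∀ j, Continuous fun t => sincPi (c j * t) := fun j =>
    continuous_sincPi.comp (continuous_const.mul continuous_id)
  have hft := intervalIntegral.integral_eq_sub_of_hasDerivAt (a := -A) (b := A) (fun t _ => hd t)
    (Continuous.intervalIntegrable (continuous_finsetSum _ fun k _ =>
      (continuous_finsetProd _ fun j _ => hs j).smul (continuous_const.mul (hk k)).neg) _ _)
  have hint : ∀ k ∈ s, IntervalIntegrable (fun t => (∏ j ∈ s.erase k, -sineInt (c j * t)) •
      -(c k * sincPi (c k * t))) volume (-A) A := fun k _ =>
    Continuous.intervalIntegrable ((continuous_finsetProd _ fun j _ => hs j).smul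
      (continuous_const.mul (hk k)).neg) _ _
  rw [← neg_sub, ← hft, intervalIntegral.integral_finsetSum hint, ← Finset.sum_neg_distrib]
  refine Finset.sum_congr rfl fun k _ => ?_
  rw [← intervalIntegral.integral_neg, ← intervalIntegral.integral_const_mul]
  congr 1; ext t
  rw [smul_eq_mul]; ring

/-! ### Local behaviour of the partial sums -/

theorem tame_bernoulliPartial {q : ℕ} (hq : 1 ≤ q) (a m y : ℝ) :
    Tame a fun N x => bernoulliPartial q N (m * (x + y)) := by
  obtain ⟨C, hC⟩ := exists_norm_bernoulliPartial_le hq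
  exact ⟨fun N => (continuous_bernoulliPartial q N).comp (by fun_prop), ⟨C, fun N x _ => hC _ _⟩,
    fun x _ => exists_tendsto_bernoulliPartial hq _⟩

theorem tame_bernoulliPartial_const {q : ℕ} (hq : 1 ≤ q) (a y : ℝ) :
    Tame a fun N _ => bernoulliPartial q N y :=
  Tame.const (exists_tendsto_bernoulliPartial hq y).choose_spec

theorem near_bernoulliPartial_of_two_le {q : ℕ} (hq : 2 ≤ q) (a m y : ℝ) :
    Near a (fun N x => bernoulliPartial q N (m * (x + y)))
      fun N _ => bernoulliPartial q N (m * y) := by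
  obtain ⟨C, hC⟩ := exists_lipschitz_bernoulliPartial hq
  refine ⟨tame_bernoulliPartial (by omega) a m y, tame_bernoulliPartial_const (by omega) a _,
    C * |m|, fun N x _ => (hC N _ _).trans_eq ?_⟩
  rw [← mul_sub, add_sub_cancel_right, abs_mul, mul_assoc]

theorem near_bernoulliPartial_of_fract_ne_zero {q : ℕ} (hq : 1 ≤ q) (a : ℝ) {m y : ℝ} (hm : 0 < m)
    (hy : Int.fract (m * y) ≠ 0) :
    Near a (fun N x => bernoulliPartial q N (m * (x + y)))
      fun N _ => bernoulliPartial q N (m * y) := by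
  rcases hq.eq_or_lt with rfl | hq
  · obtain ⟨δ, hδ, C, hC⟩ := exists_lipschitz_bernoulliPartial_one hy
    refine Near.of_local (δ := δ / m) (C := C * m) (tame_bernoulliPartial le_rfl a m y)
      (tame_bernoulliPartial_const le_rfl a _) (by positivity) fun N x hx => ?_
    have e : |m * (x + y) - m * y| = m * |x| := by
      rw [← mul_sub, add_sub_cancel_right, abs_mul, abs_of_pos hm]
    have h := hC N (m * (x + y)) (by
      rw [e]
      rw [le_div_iff₀ hm] at hx
      linarith)
    rwa [e, ← mul_assoc] at h
  · exact near_bernoulliPartial_of_two_le hq a m y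

theorem tame_neg_sineInt (a : ℝ) {m : ℝ} (hm : 0 < m) :
    Tame a fun N x => -sineInt (m * (oddFreq N * x)) := by
  obtain ⟨C, hC⟩ := exists_norm_sineInt_le
  refine ⟨fun N => (continuous_sineInt.comp (by fun_prop)).neg,
    ⟨C, fun N x _ => by rw [norm_neg]; exact hC _⟩, fun x _ => ?_⟩
  rcases lt_trichotomy x 0 with h | rfl | h
  · exact ⟨_, (tendsto_sineInt_atBot.comp
      ((tendsto_oddFreq.atTop_mul_const_of_neg h).const_mul_atBot hm)).neg⟩
  · simp only [mul_zero]
    exact ⟨_, tendsto_const_nhds⟩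
  · exact ⟨_, (tendsto_sineInt_atTop.comp
      ((tendsto_oddFreq.atTop_mul_const h).const_mul_atTop hm)).neg⟩

/-- Because of the jump, no constant approximates the partial sums near 0; the rescaled sine
integral does. The `x + 0` is the shift `x + i/ν_k` at `i = 0`. -/
theorem near_bernoulliPartial_one_sineInt (a : ℝ) {m : ℝ} (hm : 0 < m) :
    Near a (fun N x => bernoulliPartial 1 N (m * (x + 0)))
      fun N x => -sineInt (m * (oddFreq N * x)) := by
  refine Near.of_local (δ := 1 / 2 / m) (C := 4 * m) (tame_bernoulliPartial le_rfl a m 0)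
    (tame_neg_sineInt a hm) (by positivity) fun N x hx => ?_
  have hmx : |m * x| = m * |x| := by rw [abs_mul, abs_of_pos hm]
  have h := (bernoulliPartial_one_add_sineInt N (x := m * x) (by
    rw [hmx]
    rw [le_div_iff₀ hm] at hx
    linarith)).1
  rw [hmx] at h
  rw [add_zero, sub_neg_eq_add, show m * (oddFreq N * x) = oddFreq N * (m * x) by ring]
  linarith

/-! ### Orthogonality -/

theorem integral_expZ (m : ℤ) : ∫ x in (0 : ℝ)..1, expZ m x = if m = 0 then 1 else 0 := by
  split_ifs with h
  · subst h; simp [expZ]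
  · have hm : (m : ℂ) ≠ 0 := by exact_mod_cast h
    have hne : 2 * (Real.pi : ℂ) * Complex.I * m ≠ 0 := mul_ne_zero Complex.two_pi_I_ne_zero hm
    have := integral_exp_mul_complex (a := 0) (b := 1) hne
    unfold expZ
    rw [this]
    have e := expZ_add_intCast m 1 0
    unfold expZ at e
    simp only [zero_add, Int.cast_one] at e
    rw [e, sub_self, zero_div]

theorem expZ_sum {r : ℕ} (ν : Fin (r + 1) → ℕ) (n : Fin (r + 1) → ℤ) (x : ℝ) :
    ∏ j, expZ (n j) (ν j * x) = expZ (∑ j, (ν j : ℤ) * n j) x := by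
  unfold expZ
  rw [← Complex.exp_sum]
  congr 1
  push_cast
  rw [Finset.mul_sum, Finset.sum_mul]
  exact Finset.sum_congr rfl fun j _ => by ring

/-- Bounding every coordinate, including the `k`-th, makes the truncated sum a product of
one-variable sums; the integral then selects the frequencies with `∑ ν_j n_j = 0`. -/
theorem zetaPartial_eq_integral {r : ℕ} (ν q : Fin (r + 1) → ℕ) (k : Fin (r + 1)) (N : ℕ) :
    zetaPartial ν q k N = ∫ x in (0 : ℝ)..1, ∏ j, powSum (dropExponent q k j) N (ν j * x) := by
  have e : ∀ x : ℝ, ∏ j, powSum (dropExponent q k j) N (ν j * x) =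
      ∑ n ∈ Fintype.piFinset fun _ : Fin (r + 1) => Finset.Icc (-(N : ℤ)) (N : ℤ),
        invPow (dropExponent q k) n * expZ (∑ j, (ν j : ℤ) * n j) x := by
    intro x
    unfold powSum
    rw [Finset.prod_univ_sum]
    refine Finset.sum_congr rfl fun n _ => ?_
    rw [Finset.prod_mul_distrib, expZ_sum]
    rfl
  simp only [e]
  rw [intervalIntegral.integral_finsetSum]
  swap
  · exact fun n _ =>
      Continuous.intervalIntegrable (continuous_const.mul (continuous_expZ _)) _ _
  simp only [intervalIntegral.integral_const_mul, integral_expZ, mul_ite, mul_one, mul_zero]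
  rw [zetaPartial, Finset.sum_filter]

/-- Since `q k = 1`, omitting `k` leaves total exponent `|q| - 1` and `r` signs; exponents 1
contribute factorial 1. -/
theorem reciprocityConst_eq {r : ℕ} {q : Fin (r + 1) → ℕ} (hq : ∀ j, 0 < q j) {k : Fin (r + 1)}
    (hk : q k = 1) : ∏ j ∈ Finset.univ.erase k, bernoulliConst (q j) = reciprocityConst q := by
  have h1 : ∏ j ∈ Finset.univ.erase k, ((q j).factorial : ℂ) =
      ∏ j with 1 < q j, ((q j).factorial : ℂ) := by
    refine (Finset.prod_subset (fun j hj => ?_) fun j _ hj => ?_).symm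
    · rw [Finset.mem_filter] at hj
      rw [Finset.mem_erase]
      exact ⟨fun h => by rw [h] at hj; omega, Finset.mem_univ _⟩
    · have : q j = 1 := by
        have := hq j
        simp only [Finset.mem_filter, Finset.mem_univ, true_and] at hj
        omega
      simp [this]
  have h2 : (∑ j, q j) - 1 = ∑ j ∈ Finset.univ.erase k, q j := by
    rw [← Finset.add_sum_erase _ _ (Finset.mem_univ k), hk]; omega
  unfold bernoulliConst
  rw [reciprocityConst, ← h1, h2, ← Finset.prod_pow_eq_pow_sum, Finset.prod_div_distrib,
    Finset.prod_neg, Finset.card_erase_of_mem (Finset.mem_univ k), Finset.card_univ,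
    Fintype.card_fin, Nat.add_sub_cancel]
  ring

/-! ### Localization of the integral at the points `i/ν_k` -/

theorem integral_unit_eq_sum {F : ℝ → ℂ} (hF : Continuous F) (hper : Function.Periodic F 1) {m : ℕ}
    (hm : 0 < m) {a : ℝ} (ha : (m : ℝ) * a = 1 / 2) :
    ∫ x in (0 : ℝ)..1, F x = ∑ i ∈ Finset.range m, ∫ x in (-a)..a, F (x + i / m) := by
  have hm' : (m : ℝ) ≠ 0 := by positivity
  have ha' : a = 1 / 2 / m := by field_simp; linarith
  have h := intervalIntegral.sum_integral_adjacent_intervals (f := F) (μ := volume)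
    (a := fun i : ℕ => (i : ℝ) / m - a) (n := m) fun i _ => hF.intervalIntegrable _ _
  -- The period is shifted to `[-a, 1 - a]`, so that the points `i/m` become midpoints of the `m`
  -- cells.
  have h0 := hper.intervalIntegral_add_eq (-a) 0
  rw [zero_add] at h0
  rw [← h0]
  have e : ∫ x in (-a)..(-a + 1), F x = ∫ x in (((0 : ℕ) : ℝ) / m - a)..((m : ℝ) / m - a), F x := by
    congr 1
    · simp
    · rw [div_self hm']; ring
  rw [e, ← h]
  refine Finset.sum_congr rfl fun i _ => ?_
  rw [intervalIntegral.integral_comp_add_right]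
  congr 1
  · ring
  · rw [ha']; push_cast; field_simp; ring

/-- The only use of coprimality: away from the origin no other factor meets its jump. -/
theorem fract_mul_div_ne_zero {i m n : ℕ} (hi : 0 < i) (hin : i < n) (hmn : Nat.Coprime m n) :
    Int.fract ((m : ℝ) * (i / n)) ≠ 0 := by
  intro h
  rw [Int.fract, sub_eq_zero] at h
  have hn : (n : ℝ) ≠ 0 := by
    have : 0 < n := by omega
    positivity
  rw [mul_div_assoc', div_eq_iff hn] at h
  have h1 : (m : ℤ) * i = ⌊(m : ℝ) * i / n⌋ * n := by exact_mod_cast h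
  have h2 : (n : ℤ) ∣ (m * i : ℕ) := ⟨_, by push_cast; rw [h1, mul_comm]⟩
  have h3 : n ∣ i := hmn.symm.dvd_of_dvd_mul_left (Int.natCast_dvd_natCast.1 h2)
  exact absurd (Nat.le_of_dvd hi h3) (by omega)

theorem zetaPartial_mul_reciprocityConst {r : ℕ} {ν q : Fin (r + 1) → ℕ} (hν : ∀ j, 0 < ν j)
    (hq : ∀ j, 0 < q j) {k : Fin (r + 1)} (hk : q k = 1) {a : ℝ} (ha : (ν k : ℝ) * a = 1 / 2)
    (N : ℕ) :
    reciprocityConst q * zetaPartial ν q k N = ∑ i ∈ Finset.range (ν k), ∫ x in (-a)..a,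
      powSum 0 N (ν k * x) *
        ∏ j ∈ Finset.univ.erase k, bernoulliPartial (q j) N (ν j * (x + i / ν k)) := by
  have hprod : ∀ x : ℝ, reciprocityConst q * ∏ j, powSum (dropExponent q k j) N (ν j * x) =
      powSum 0 N (ν k * x) * ∏ j ∈ Finset.univ.erase k, bernoulliPartial (q j) N (ν j * x) := by
    intro x
    rw [← Finset.mul_prod_erase _ _ (Finset.mem_univ k), ← reciprocityConst_eq hq hk]
    unfold bernoulliPartial
    rw [Finset.prod_mul_distrib, dropExponent, Function.update_self]
    have : ∏ j ∈ Finset.univ.erase k, powSum (Function.update q k 0 j) N (ν j * x) =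
        ∏ j ∈ Finset.univ.erase k, powSum (q j) N (ν j * x) :=
      Finset.prod_congr rfl fun j hj => by rw [Function.update_of_ne (Finset.ne_of_mem_erase hj)]
    rw [this]
    ring
  rw [zetaPartial_eq_integral, ← intervalIntegral.integral_const_mul]
  simp only [hprod]
  rw [integral_unit_eq_sum _ _ (hν k) ha]
  · refine Finset.sum_congr rfl fun i _ => ?_
    congr 1; ext x
    congr 1
    have h0 : (ν k : ℝ) ≠ 0 := by have := hν k; positivity
    rw [mul_add, mul_div_cancel₀ _ h0]
    exact_mod_cast powSum_add_intCast 0 N (ν k * x) i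
  · exact ((continuous_powSum 0 N).comp (by fun_prop)).mul (continuous_finsetProd _ fun j _ =>
      (continuous_bernoulliPartial _ N).comp (by fun_prop))
  · intro x
    have e1 := powSum_add_intCast 0 N (ν k * x) (ν k)
    have e2 := fun j => bernoulliPartial_add_intCast (q j) N (ν j * x) (ν j)
    push_cast at e1 e2
    simp only [mul_add, mul_one, e1, e2]

/-- The convergence of the partial sums of `ζ_{k,ν,q}` for `q_k = 1`, with the contributions of the
points `i/ν_k`, `i ≠ 0`, and of the origin to the limit. -/
theorem exists_tendsto_zetaPartial {r : ℕ} {ν q : Fin (r + 1) → ℕ} (hν : ∀ j, 0 < ν j)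
    (hcop : ∀ i j, i ≠ j → Nat.Coprime (ν i) (ν j)) (hq : ∀ j, 0 < q j)
    {k : Fin (r + 1)} (hk : q k = 1) :
    ∃ T : ℂ, Tendsto (fun A : ℝ => ∫ t in (-A)..A, sincPi (ν k * t) *
        ∏ j ∈ (Finset.univ.filter fun j => q j = 1).erase k, -sineInt (ν j * t)) atTop (𝓝 T) ∧
      Tendsto (fun N => reciprocityConst q * zetaPartial ν q k N) atTop
        (𝓝 ((∏ j with q j ≠ 1, ((bernoulli (q j) : ℚ) : ℂ)) * T +
          dedekindSum (fun j => periodicBernoulli (q j)) ν k / ν k)) := by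
  have hνr : ∀ j, (0 : ℝ) < ν j := fun j => by have := hν j; positivity
  set a : ℝ := 1 / 2 / ν k with ha_def
  have ha : (ν k : ℝ) * a = 1 / 2 := by have := (hνr k).ne'; rw [ha_def]; field_simp
  set S := Finset.univ.filter fun j => q j = 1 with hS
  obtain ⟨Q, hQ⟩ := SlowlyVarying.exists_prod (S.erase k)
    fun j _ => slowlyVarying_neg_sineInt (hνr j)
  obtain ⟨T, hT⟩ := hQ.exists_tendsto (hνr k)
  refine ⟨T, hT, ?_⟩
  simp only [zetaPartial_mul_reciprocityConst hν hq hk ha]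
  -- The cell at the origin is separated from those at `i/ν_k`, `i ≥ 1`, which form the Dedekind
  -- sum.
  have hrange : Finset.range (ν k) = insert 0 (Finset.Ico 1 (ν k)) := by
    ext i; have := hν k; simp only [Finset.mem_range, Finset.mem_insert, Finset.mem_Ico]; omega
  rw [hrange]
  simp only [Finset.sum_insert (show (0 : ℕ) ∉ Finset.Ico 1 (ν k) by simp)]
  refine Tendsto.add ?_ ?_
  · have hu : Tendsto (fun N => ∏ j with q j ≠ 1, bernoulliPartial (q j) N (ν j * 0)) atTop
        (𝓝 (∏ j with q j ≠ 1, ((bernoulli (q j) : ℚ) : ℂ))) := by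
      refine tendsto_finsetProd _ fun j hj => ?_
      have hj1 : q j ≠ 1 := (Finset.mem_filter.1 hj).2
      have := tendsto_bernoulliPartial (hq j) (x := ν j * 0) (Or.inl hj1)
      convert! this using 2
      rw [periodicBernoulli, mul_zero, Int.fract_zero, bernoulliFun_eval_zero]
      simp
    have hH : Tame a fun N x => ∏ j ∈ S.erase k, -sineInt (ν j * (oddFreq N * x)) :=
      (Near.prod (S.erase k) fun j _ => near_bernoulliPartial_one_sineInt a (hνr j)).right
    refine tendsto_integral_dirichlet_mul_of_near_scaled (hνr k) ha hu hH ?_ hT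
    -- At the origin a factor is replaced by a sine integral if `q j = 1`, and otherwise by its
    -- value at 0, which tends to a Bernoulli number.
    have hnear := Near.prod (Finset.univ.erase k) (a := a)
      (f := fun j N x => bernoulliPartial (q j) N (ν j * (x + 0)))
      (g := fun j N x => if q j = 1 then -sineInt (ν j * (oddFreq N * x))
        else bernoulliPartial (q j) N (ν j * 0)) (fun j _ => by
        by_cases hj : q j = 1
        · simp only [hj, if_true]
          exact near_bernoulliPartial_one_sineInt a (hνr j)
        · simp only [hj, if_false]
          exact near_bernoulliPartial_of_two_le (by have := hq j; omega) a _ _)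
    have f1 : (Finset.univ.erase k).filter (fun j => q j = 1) = S.erase k := by
      rw [hS, Finset.filter_erase]
    have f2 : (Finset.univ.erase k).filter (fun j => ¬ q j = 1) =
        Finset.univ.filter fun j => q j ≠ 1 := by
      ext j
      simp only [Finset.mem_filter, Finset.mem_erase, Finset.mem_univ, and_true, true_and]
      exact ⟨fun h => h.2, fun h => ⟨fun e => h (e ▸ hk), h⟩⟩
    simp only [Finset.prod_ite, f1, f2] at hnear
    simpa only [Nat.cast_zero, zero_div, mul_comm] using hnear
  · rw [dedekindSum, Finset.sum_div]
    refine tendsto_finsetSum _ fun i hi => ?_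
    rw [Finset.mem_Ico] at hi
    have hfr : ∀ j ∈ Finset.univ.erase k, Int.fract ((ν j : ℝ) * (i / ν k)) ≠ 0 := fun j hj =>
      fract_mul_div_ne_zero (by omega) hi.2 (hcop j k (Finset.ne_of_mem_erase hj))
    refine tendsto_integral_dirichlet_mul_of_near_const (hνr k) ha
      (u := fun N => ∏ j ∈ Finset.univ.erase k, bernoulliPartial (q j) N (ν j * (i / ν k))) ?_ ?_
    · refine tendsto_finsetProd _ fun j hj => ?_
      have := tendsto_bernoulliPartial (hq j) (Or.inr (hfr j hj))
      rwa [show (i : ℝ) * ν j / ν k = ν j * (i / ν k) by ring]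
    · exact Near.prod _ fun j hj =>
        near_bernoulliPartial_of_fract_ne_zero (hq j) a (hνr j) (hfr j hj)

/-! ### Zeta values and jumps -/

/-- In the absolutely convergent case the boxes exhaust the lattice, so the box sums also tend to
the unconditional sum. -/
theorem latticeZeta_eq_of_tendsto {r : ℕ} {ν q : Fin (r + 1) → ℕ} {k : Fin (r + 1)} {l : ℂ}
    (h : Tendsto (zetaPartial ν q k) atTop (𝓝 l)) : latticeZeta ν q k = l := by
  classical
  unfold latticeZeta
  split_ifs with hs
  · have hB : Tendsto (fun N : ℕ => (Fintype.piFinset fun _ : Fin (r + 1) =>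
        Finset.Icc (-(N : ℤ)) (N : ℤ)).subtype (· ∈ orthogonalLattice ν)) atTop atTop := by
      refine tendsto_atTop_finset_of_monotone (fun A B hAB n hn => ?_) fun n =>
        ⟨∑ j, (n.1 j).natAbs, ?_⟩
      · simp only [Finset.mem_subtype, Fintype.mem_piFinset, Finset.mem_Icc] at hn ⊢
        intro j
        have := hn j
        omega
      · simp only [Finset.mem_subtype, Fintype.mem_piFinset, Finset.mem_Icc]
        intro j
        have := Finset.single_le_sum (f := fun j => (n.1 j).natAbs) (fun _ _ => Nat.zero_le _)
          (Finset.mem_univ j)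
        omega
    refine tendsto_nhds_unique (hs.hasSum.comp hB) (h.congr fun N => ?_)
    simp only [Function.comp_apply]
    rw [Finset.sum_subtype_eq_sum_filter (f := invPow (dropExponent q k))]
    rw [zetaPartial]
    refine Finset.sum_congr ?_ fun _ _ => rfl
    ext n
    rw [Finset.mem_filter, Finset.mem_filter]
    rfl
  · exact h.limUnder_eq

/-- `B_q(1) = B_q(0)` except for `q = 1`, so only indices with `q_k = 1` enter the reciprocity. -/
theorem jump_periodicBernoulli (q : ℕ) : jump (periodicBernoulli q) = if q = 1 then 1 else 0 := by
  have hc : Continuous fun x : ℝ => (bernoulliFun q x : ℂ) :=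
    Complex.continuous_ofReal.comp (continuous_bernoulliFun q)
  have h1 : Function.leftLim (periodicBernoulli q) 1 = (bernoulliFun q 1 : ℂ) := by
    refine leftLim_eq_of_tendsto ?_
    refine ((hc.tendsto 1).mono_left nhdsWithin_le_nhds).congr' ?_
    filter_upwards [Ioo_mem_nhdsLT (show (0 : ℝ) < 1 by norm_num)] with x hx
    rw [periodicBernoulli, Int.fract_eq_self.2 ⟨hx.1.le, hx.2⟩]
  have h0 : Function.rightLim (periodicBernoulli q) 0 = (bernoulliFun q 0 : ℂ) := by
    refine rightLim_eq_of_tendsto ?_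
    refine ((hc.tendsto 0).mono_left nhdsWithin_le_nhds).congr' ?_
    filter_upwards [Ioo_mem_nhdsGT (show (0 : ℝ) < 1 by norm_num)] with x hx
    rw [periodicBernoulli, Int.fract_eq_self.2 ⟨hx.1.le, hx.2⟩]
  rw [jump, h1, h0, bernoulliFun_eval_one]
  split_ifs <;> simp

theorem reciprocityConst_ne_zero {r : ℕ} (q : Fin (r + 1) → ℕ) : reciprocityConst q ≠ 0 := by
  unfold reciprocityConst
  refine mul_ne_zero (div_ne_zero (by simp) (pow_ne_zero _ Complex.two_pi_I_ne_zero)) ?_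
  exact Finset.prod_ne_zero_iff.2 fun j _ => by exact_mod_cast (q j).factorial_ne_zero

end

end DedekindReciprocity

/-! ### Summation over `k` -/

theorem mainTheorem3 (r : ℕ) (ν q : Fin (r + 1) → ℕ)
    (hν_pos : ∀ j, 0 < ν j)
    (hν_distinct : Function.Injective ν)
    (hν_coprime : ∀ i j, i ≠ j → Nat.Coprime (ν i) (ν j))
    (hq : ∀ j, 0 < q j) :
    (∀ k, q k = 1 →
      Tendsto (DedekindReciprocity.zetaPartial ν q k) atTop
        (𝓝 (DedekindReciprocity.latticeZeta ν q k))) ∧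
    DedekindReciprocity.reciprocity
        (fun j => DedekindReciprocity.periodicBernoulli (q j)) ν =
      DedekindReciprocity.reciprocityConst q *
          ∑ k with q k = 1, (ν k : ℂ) * DedekindReciprocity.latticeZeta ν q k
        - (1 - (-1) ^ DedekindReciprocity.onesCount q) / 2 ^ DedekindReciprocity.onesCount q *
          ∏ j with q j ≠ 1, ((bernoulli (q j) : ℚ) : ℂ) := by
  open DedekindReciprocity in
  have hK := reciprocityConst_ne_zero q
  have key : ∀ k, q k = 1 → ∃ T : ℂ, Tendsto (fun A : ℝ => ∫ t in (-A)..A, sincPi (ν k * t) *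
        ∏ j ∈ (Finset.univ.filter fun j => q j = 1).erase k, -sineInt (ν j * t)) atTop (𝓝 T) ∧
      Tendsto (zetaPartial ν q k) atTop (𝓝 (latticeZeta ν q k)) ∧
      reciprocityConst q * ((ν k : ℂ) * latticeZeta ν q k) =
        (∏ j with q j ≠ 1, ((bernoulli (q j) : ℚ) : ℂ)) * (ν k * T) +
          dedekindSum (fun j => periodicBernoulli (q j)) ν k := by
    intro k hk
    obtain ⟨T, hT, hlim⟩ := exists_tendsto_zetaPartial hν_pos hν_coprime hq hk
    have h := (hlim.div_const (reciprocityConst q)).congr fun N =>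
      mul_div_cancel_left₀ (zetaPartial ν q k N) hK
    refine ⟨T, hT, ?_⟩
    rw [latticeZeta_eq_of_tendsto h]
    refine ⟨h, ?_⟩
    have : (ν k : ℂ) ≠ 0 := by exact_mod_cast (hν_pos k).ne'
    field_simp
  choose! T hT hconv hval using key
  refine ⟨hconv, ?_⟩
  have hsum : ∑ k with q k = 1, (ν k : ℂ) * T k =
      (1 - (-1) ^ onesCount q) / 2 ^ onesCount q := by
    -- Only the weighted sum of the `T k` is known in closed form, so it is identified as a limit of
    -- the truncated sums.
    refine tendsto_nhds_unique (tendsto_finsetSum _ fun k hk =>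
      (hT k (Finset.mem_filter.1 hk).2).const_mul (ν k : ℂ)) ?_
    have h := tendsto_sum_integral_sincPi_mul_prod (Finset.univ.filter fun j => q j = 1)
      (c := fun j => (ν j : ℝ)) fun j => by have := hν_pos j; positivity
    simpa only [Complex.ofReal_natCast, onesCount] using h
  have hrec : reciprocity (fun j => periodicBernoulli (q j)) ν =
      ∑ k with q k = 1, dedekindSum (fun j => periodicBernoulli (q j)) ν k := by
    rw [reciprocity, Finset.sum_filter]
    refine Finset.sum_congr rfl fun k _ => ?_
    rw [jump_periodicBernoulli]
    split_ifs <;> simp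
  rw [hrec, Finset.mul_sum, Finset.sum_congr rfl fun k hk => hval k (Finset.mem_filter.1 hk).2,
    Finset.sum_add_distrib, ← Finset.mul_sum, hsum]
  ring
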